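/- **Scaling Ising model: recursion for $I_n$ and $\Delta=1/16$.** Let $\sigma$ and $\mu$ have the $n$-particle form factors $$\sigma_n(\underline\theta)=(2i)^{\frac{n-1}{2}}\prod_{i<j}\tanh\tfrac12\theta_{ij}\ \ (n\text{ odd}),\qquad \mu_n(\underline\theta)=(2i)^{\frac n2}\prod_{i<j}\tanh\tfrac12\theta_{ij}\ \ (n\text{ even}),$$ and zero for the other parities, where $\theta_{ij}=\theta_i-\theta_j$. For $\mathcal O=\mu+\sqrt{2i}\,\sigma$, with form factors $\mathcal O_n=\mu_n+\sqrt{2i}\,\sigma_n$, put $g_n(\underline\theta)=(4\pi)^{-n}|\mathcal O_n(\underline\theta)|^2$. Let $h_n$ ($n\ge1$) be the connected parts (cumulants) of the $g_n$, i.e. the functions determined by $$g_I=\sum_{I_1\cup\dots\cup I_k=I}h_{I_1}\cdots h_{I_k},$$ where the sum runs over all set partitions of $I=\{1,\dots,n\}$ and $g_J$, $h_J$ denote $g_{|J|}$, $h_{|J|}$ evaluated at the rapidities $\theta_j$, $j\in J$. For $n\ge1$ let $$I_n=(2\pi)^n\int d\theta_1\cdots\int d\theta_{n-1}\,h_n(\theta_1,\dots,\theta_{n-1},0),\qquad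 \Delta=\frac12\sum_{n=1}^\infty\frac1{n!}\int d\theta_1\cdots\int d\theta_{n-1}\,h_n(\theta_1,\dots,\theta_{n-1},0).$$ Then the following hold. 1. $g_n(\underline\theta)=(2\pi)^{-n}\prod_{i<j}\tanh^2\tfrac12\theta_{ij}$ for all $n\ge 0$. 2. For every $n\ge1$ the function $h_n(\theta_1,\dots,\theta_{n-1},0)$ is integrable over $\mathbb R^{n-1}$, and $$I_1=1,\qquad I_2=-4,\qquad I_3=4\pi^2,\qquad I_n=(n-2)^2I_3\,I_{n-2}\quad(n\ge3).$$ 3. The contributions of the odd particle numbers $n=2k+1$ $(k\ge0)$ and of the even particle numbers $n=2k$ $(k\ge1)$ are, term by term, $$\frac12\frac{(2\pi)^{-(2k+1)}}{(2k+1)!}I_{2k+1}=\frac1{4\pi}\frac{\Gamma^2(2k+1)}{\Gamma^2(k+1)\Gamma(2k+2)}4^{-k},\qquad \frac12\frac{(2\pi)^{-2k}}{(2k)!}I_{2k}=-\frac1{8\pi^2}\frac{\Gamma^2(k)}{\Gamma(2k+1)}4^{k},$$ and they sum to $\frac18$ and to $-\frac1{16}$, respectively. The series for $\Delta$ converges absolutely,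 and $$\Delta=\frac12\sum_{n=1}^\infty\frac1{n!}\Big(\frac1{2\pi}\Big)^nI_n=\frac18-\frac1{16}=\frac1{16}.$$ 4. $\Delta$ is the short-distance dimension of $\mathcal O$: for mass $m>0$ and every $\tau>0$, all integrals and the series in $$w(\tau)=\sum_{n=0}^\infty\frac1{n!}\int d\theta_1\cdots\int d\theta_n\,e^{-\tau m\sum_i\cosh\theta_i}\,g_n(\underline\theta)$$ (the two-point function $\langle 0|\mathcal O(x)\mathcal O^\dagger(0)|0\rangle$ at $x=(-i\tau,0)$) converge absolutely, and $\dfrac{\ln w(\tau)}{\ln(m\tau)}\to-4\Delta$ as $\tau\to0^+$. -/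

import Mathlib

open Filter Topology MeasureTheory

namespace ScalingIsing

noncomputable section

/-- The common factor `∏_{i<j} tanh (θ_ij / 2)`, with `θ_ij = θ_i - θ_j`. -/
def tanhProd (n : ℕ) (θ : Fin n → ℝ) : ℝ :=
  ∏ i : Fin n, ∏ j ∈ Finset.Ioi i, Real.tanh ((θ i - θ j) / 2)

/-- The `n`-particle form factor `⟨0|σ(0)|p₁,…,pₙ⟩` of the order parameter;
it vanishes for even `n`. -/
def formFactorSigma (n : ℕ) (θ : Fin n → ℝ) : ℂ :=
  if Odd n then (2 * Complex.I) ^ ((n - 1) / 2) * (tanhProd n θ : ℂ) else 0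

/-- The `n`-particle form factor `⟨0|μ(0)|p₁,…,pₙ⟩` of the disorder parameter;
it vanishes for odd `n`. -/
def formFactorMu (n : ℕ) (θ : Fin n → ℝ) : ℂ :=
  if Even n then (2 * Complex.I) ^ (n / 2) * (tanhProd n θ : ℂ) else 0

/-- The `n`-particle form factor of the operator `O = μ + √(2i) σ`. -/
def formFactor (n : ℕ) (θ : Fin n → ℝ) : ℂ :=
  formFactorMu n θ + (2 * Complex.I) ^ (1 / 2 : ℂ) * formFactorSigma n θ

/-- The density `gₙ(θ) = (4π)^{-n} ⟨0|O(0)|p₁,…,pₙ⟩ ⟨pₙ,…,p₁|O†(0)|0⟩`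
of the `n`-particle intermediate states in `⟨0|O(x) O†(0)|0⟩`. -/
def g (n : ℕ) (θ : Fin n → ℝ) : ℝ :=
  ((4 * Real.pi) ^ n)⁻¹ * ‖formFactor n θ‖ ^ 2

/-- The restriction of the rapidities `θ` to the labels in `B`, in increasing order. -/
def restrict {n : ℕ} (θ : Fin n → ℝ) (B : Finset (Fin n)) : Fin B.card → ℝ :=
  fun k => θ (B.orderEmbOfFin rfl k)

/-- The connected parts (cumulants) `hₙ` of the functions `gₙ`, defined recursively by solving
`g_I = ∑_{I₁ ∪ … ∪ I_k = I} h_{I₁} ⋯ h_{I_k}` (the sum runs over the set partitions of `I`)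
for the term `h_I` of the partition with the single block `I`; see `g_eq_sum_h`. -/
def h (n : ℕ) (θ : Fin n → ℝ) : ℝ :=
  g n θ - ∑ π : {π : Finpartition (Finset.univ : Finset (Fin n)) // Finset.univ ∉ π.parts},
    ∏ B : {B : Finset (Fin n) // B ∈ π.1.parts}, h B.1.card (restrict θ B.1)
termination_by n
decreasing_by
  have hB : B.1 ≠ Finset.univ := fun e => π.2 (Set.mem_of_eq_of_mem e.symm B.2)
  simpa using Finset.card_lt_card (Finset.ssubset_univ_iff.2 hB)

theorem h_card_univ (n : ℕ) (θ : Fin n → ℝ) :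
    h (Finset.univ : Finset (Fin n)).card (restrict θ Finset.univ) = h n θ := by
  have key : ∀ (m : ℕ) (e : m = n), h m (fun k => θ (Fin.cast e k)) = h n θ := by
    intro m e; subst e; rfl
  rw [← key _ (Finset.card_fin n)]
  congr 1
  funext k
  have : (Finset.univ : Finset (Fin n)).orderEmbOfFin rfl =
      (Fin.castOrderIso (Finset.card_fin n)).toOrderEmbedding := by
    symm
    apply Finset.orderEmbOfFin_unique'
    simp
  exact congrArg θ (DFunLike.congr_fun this k)

/-- The defining relation between the `g`'s and the `h`'s:
a sum over all set partitions of the labels. -/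
theorem g_eq_sum_h (n : ℕ) (θ : Fin n → ℝ) :
    g n θ = ∑ π : Finpartition (Finset.univ : Finset (Fin n)),
      ∏ B ∈ π.parts, h B.card (restrict θ B) := by
  classical
  rcases Nat.eq_zero_or_pos n with rfl | hn
  · have hp : ∀ π : Finpartition (Finset.univ : Finset (Fin 0)), π.parts = ∅ :=
      fun π => Finpartition.parts_eq_empty_iff.2 rfl
    have hu : Fintype.card (Finpartition (Finset.univ : Finset (Fin 0))) = 1 :=
      Fintype.card_eq_one_iff.2 ⟨Finpartition.empty _, fun π => Finpartition.ext (hp π)⟩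
    simp only [hp, Finset.prod_empty, Finset.sum_const, Finset.card_univ, hu]
    simp [g, formFactor, formFactorMu, formFactorSigma, tanhProd]
  · have hne : (Finset.univ : Finset (Fin n)) ≠ ⊥ := by
      have : Nonempty (Fin n) := ⟨⟨0, hn⟩⟩
      exact Finset.univ_nonempty.ne_empty
    have hiff : ∀ π : Finpartition (Finset.univ : Finset (Fin n)),
        Finset.univ ∈ π.parts ↔ π = Finpartition.indiscrete hne := by
      intro π
      constructor
      · intro hu
        ext B
        rw [Finpartition.indiscrete_parts, Finset.mem_singleton]
        constructor
        · intro hB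
          obtain ⟨x, hx⟩ := π.nonempty_of_mem_parts hB
          exact π.eq_of_mem_parts hB hu hx (Finset.mem_univ x)
        · rintro rfl; exact hu
      · rintro rfl; simp
    rw [← Finset.sum_filter_not_add_sum_filter _ (fun π => Finset.univ ∈ π.parts)]
    have h1 : (Finset.univ.filter
        fun π : Finpartition (Finset.univ : Finset (Fin n)) => Finset.univ ∈ π.parts) =
        {Finpartition.indiscrete hne} := by
      ext π; simp [hiff]
    have h2 : (∑ π : {π : Finpartition (Finset.univ : Finset (Fin n)) // Finset.univ ∉ π.parts},
        ∏ B : {B : Finset (Fin n) // B ∈ π.1.parts}, h B.1.card (restrict θ B.1)) =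
        ∑ π : Finpartition (Finset.univ : Finset (Fin n)) with Finset.univ ∉ π.parts,
          ∏ B ∈ π.parts, h B.card (restrict θ B) := by
      rw [Finset.sum_subtype (p := fun π : Finpartition (Finset.univ : Finset (Fin n)) =>
        Finset.univ ∉ π.parts) (F := inferInstance) _ (by simp)]
      refine Finset.sum_congr rfl fun π _ => ?_
      exact Finset.prod_coe_sort π.1.parts (fun B => h B.card (restrict θ B))
    rw [h1, Finset.sum_singleton, Finpartition.indiscrete_parts, Finset.prod_singleton,
      h_card_univ, ← h2, h]
    ring

/-- `Iₙ = (2π)ⁿ ∫ dθ₁ ⋯ dθ_{n-1} hₙ(θ₁,…,θ_{n-1},0)` for `n ≥ 1` (the value at `0` is unused). -/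
def rapidityIntegral : ℕ → ℝ
  | 0 => 0
  | n + 1 => (2 * Real.pi) ^ (n + 1) *
      ∫ θ : Fin n → ℝ, h (n + 1) (Fin.snoc (α := fun _ => ℝ) θ 0)

/-- The dimension `Δ = ½ ∑_{n≥1} (1/n!) ∫ dθ₁ ⋯ dθ_{n-1} hₙ(θ₁,…,θ_{n-1},0)`. -/
def dimension : ℝ :=
  1 / 2 * ∑' n : ℕ, ((n + 1).factorial : ℝ)⁻¹ *
    ∫ θ : Fin n → ℝ, h (n + 1) (Fin.snoc (α := fun _ => ℝ) θ 0)

/-- The integrand `e^{-ix∑pᵢ} gₙ(θ)` at `x = (-iτ, 0)`, `pᵢ = m (cosh θᵢ, sinh θᵢ)`. -/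
def twoPointIntegrand (m τ : ℝ) (n : ℕ) (θ : Fin n → ℝ) : ℝ :=
  Real.exp (-(τ * m * ∑ i, Real.cosh (θ i))) * g n θ

/-- The `n`-particle contribution to the two-point function `⟨0|O(x) O†(0)|0⟩`. -/
def twoPointTerm (m τ : ℝ) (n : ℕ) : ℝ :=
  (n.factorial : ℝ)⁻¹ * ∫ θ : Fin n → ℝ, twoPointIntegrand m τ n θ

/-- The two-point function `w(x) = ⟨0|O(x) O†(0)|0⟩` at `x = (-iτ, 0)`,
as the sum over all intermediate states. -/
def twoPoint (m τ : ℝ) : ℝ := ∑' n : ℕ, twoPointTerm m τ n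

end

end ScalingIsing

/-!
The kernel `K(x, y) = sech ((x - y) / 2) / (2π)` controls everything. One step of Gaussian
elimination on the matrix `sech ((θᵢ - θⱼ) / 2)` multiplies row `i` and column `j` by `tanh`,
because `sech (a - b) - sech a * sech b = tanh a * tanh b * sech (a - b)`; hence
`gₙ = det K(θᵢ, θⱼ)` (`g_eq_kernelDet`). Sorting the permutations in a determinant by their cycles
is a decomposition over set partitions, so the cumulant `hₙ` is `(-1)^(n-1)` times the sum over
the `(n - 1)!` cyclic permutations of the products of `K` along the cycle
(`kernelDet_eq_sum_finpartition`, `h_eq_cycleSum`). The cycles are handled without permutation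
groups: `pathSum` sums over orderings of the intermediate points, and Fredholm's expansion of a
bordered determinant (`borderedDet_expand`) produces it.

Each cycle integrates to the same value, an iterated kernel on the diagonal. Euler's Beta integral
and the reflection formula of the Gamma function show that `K` has the Fourier transform
`sech (πk)` (`integral_kern_mul_cos`), so that this value is `(2π²)⁻¹ ∫ sechⁿ`
(`iterKernel_one_diag`). Integration by parts gives the recursion for `Iₙ`, and the sums over odd
and over even `n` telescope with the help of the integrals `∫ x cosᵐ x` (`hasSum_sechInt`), giving
`1/8` and `-1/16`.

The two-point function is the Fredholm determinant of `1 + K_a`, where `K_a` is `K` damped by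
`exp (-a cosh x)`, `a = mτ`. Fredholm's recursion for the first minor turns into
`(n + 1) w_{n+1} = ∑ₖ (-1)ᵏ Tr K_a^(k+1) w_{n-k}`, hence `log w = ∑ₖ (-1)ᵏ Tr K_a^(k+1) / (k + 1)`
(`IsWeight.log_tsum_fredholmTerm`). In the variable `s = x / log (1/a)` the damping converges to
the indicator function of `|s| < 1`, so `Tr K_a^(k+1) / log (1/a)` tends to twice the diagonal
value of the iterated kernel (`tendsto_kernelTrace_div`). Dominated convergence in `s` and in `k`
gives `log w / log (1/a) → 4Δ`.
-/

namespace ScalingIsing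

/-! ### Cycle expansion of determinants -/

section Algebra

variable {R X α β ι κ : Type*} [CommRing R]

/-- Laplace expansion along the row `none`. In the minor belonging to `j` the column `j` is replaced
by the column `none`, rather than deleted, so that all signs are equal. -/
theorem det_option [Fintype α] [DecidableEq α] (M : Matrix (Option α) (Option α) R) :
    M.det = M none none * (M.submatrix some some).det -
      ∑ j, M none (some j) *
        (Matrix.of fun i k => M (some i) (if k = j then none else some k)).det := by
  rw [← Matrix.det_transpose, Matrix.det_apply', ← Equiv.Perm.decomposeOption.symm.sum_comp,
    Fintype.sum_prod_type, Fintype.sum_option, sub_eq_add_neg, ← Finset.sum_neg_distrib]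
  congr 1
  · rw [← Matrix.det_transpose (M.submatrix some some), Matrix.det_apply', Finset.mul_sum]
    refine Finset.sum_congr rfl fun τ _ => ?_
    simp [Fintype.prod_option]
    ring
  · refine Finset.sum_congr rfl fun j _ => ?_
    rw [← Matrix.det_transpose (Matrix.of _), Matrix.det_apply', Finset.mul_sum,
      ← Finset.sum_neg_distrib]
    refine Finset.sum_congr rfl fun τ _ => ?_
    have h1 : ∀ a : α, Equiv.swap none (some j) (some (τ a)) =
        if τ a = j then none else some (τ a) := by
      intro a
      simp [Equiv.swap_apply_def]
    simp [Fintype.prod_option, h1]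
    ring

/-- Fredholm's minor: the determinant of the matrix `A (θ i) (θ j)` bordered by one more row,
indexed by the point `x`, and one more column, indexed by the point `y`. -/
def borderedDet [Fintype α] [DecidableEq α] (A : X → X → R) (θ : α → X) (x y : X) : R :=
  (Matrix.of fun a b : Option α => A (a.elim x θ) (b.elim y θ)).det

/-- The determinant of the matrix `A (θ i) (θ j)`. -/
def kernelDet [Fintype α] [DecidableEq α] (A : X → X → R) (θ : α → X) : R :=
  (Matrix.of fun a b : α => A (θ a) (θ b)).det

theorem kernelDet_equiv [Fintype α] [DecidableEq α] [Fintype β] [DecidableEq β]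
    (A : X → X → R) (θ : α → X) (e : β ≃ α) :
    kernelDet A (fun b => θ (e b)) = kernelDet A θ :=
  Matrix.det_submatrix_equiv_self e (Matrix.of fun a b : α => A (θ a) (θ b))

theorem borderedDet_self_eq [Fintype α] [DecidableEq α] [Fintype β] [DecidableEq β]
    (A : X → X → R) (θ : α → X) (e : Option β ≃ α) :
    borderedDet A (fun b => θ (e (some b))) (θ (e none)) (θ (e none)) = kernelDet A θ := by
  rw [← kernelDet_equiv A θ e]
  unfold borderedDet kernelDet
  congr 1
  ext a b
  rcases a with _ | a <;> rcases b with _ | b <;> rfl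

/-- Expansion of Fredholm's minor along the row of `x`. The equivalence `e j` identifies `β j`
with the indices other than `j`; the minors that occur are again bordered determinants, with the
point `x` replaced by `θ j`. -/
theorem borderedDet_expand [Fintype α] [DecidableEq α] {β : α → Type*} [∀ j, Fintype (β j)]
    [∀ j, DecidableEq (β j)] (A : X → X → R) (θ : α → X) (x y : X)
    (e : ∀ j, Option (β j) ≃ α) (he : ∀ j, e j none = j) :
    borderedDet A θ x y = A x y * kernelDet A θ -
      ∑ j, A x (θ j) * borderedDet A (fun b => θ (e j (some b))) (θ j) y := by
  unfold borderedDet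
  rw [det_option]
  congr 1
  refine Finset.sum_congr rfl fun j _ => ?_
  congr 1
  rw [← Matrix.det_submatrix_equiv_self (e j)]
  congr 1
  ext a b
  rcases a with _ | a <;> rcases b with _ | b
  · simp [he]
  · have : e j (some b) ≠ j := fun h => by
      simpa using (e j).injective (h.trans (he j).symm)
    simp [he, this]
  · simp [he]
  · have : e j (some b) ≠ j := fun h => by
      simpa using (e j).injective (h.trans (he j).symm)
    simp [this]

/-- `pathSum A θ n x y J` is the sum of the products of `A` along the paths from `x` to `y` whose
`n` intermediate points are points `θ j` with distinct indices `j ∈ J`, in any order. -/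
def pathSum [DecidableEq ι] (A : X → X → R) (θ : ι → X) : ℕ → X → X → Finset ι → R
  | 0, x, y, _ => A x y
  | n + 1, x, y, J => ∑ j ∈ J, A x (θ j) * pathSum A θ n (θ j) y (J.erase j)

theorem pathSum_map [DecidableEq ι] [DecidableEq κ] (A : X → X → R) (θ : ι → X) (f : κ ↪ ι)
    (n : ℕ) (x y : X) (J : Finset κ) :
    pathSum A θ n x y (J.map f) = pathSum A (fun k => θ (f k)) n x y J := by
  induction n generalizing x J with
  | zero => rfl
  | succ n ih =>
    simp only [pathSum, Finset.sum_map]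
    refine Finset.sum_congr rfl fun j _ => ?_
    rw [← Finset.map_erase, ih]

theorem borderedDet_erase [DecidableEq ι] (A : X → X → R) (θ : ι → X) (x y : X) (J : Finset ι) :
    borderedDet A (fun a : J => θ a) x y = A x y * kernelDet A (fun a : J => θ a) -
      ∑ j ∈ J, A x (θ j) * borderedDet A (fun a : (J.erase j : Finset ι) => θ a) (θ j) y := by
  have hin : ∀ j : J, insert (j : ι) (J.erase j) = J := fun j => Finset.insert_erase j.2
  let e : ∀ j : J, Option (J.erase j : Finset ι) ≃ J := fun j =>
    (Finset.subtypeInsertEquivOption (Finset.notMem_erase (j : ι) J)).symm.trans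
      (Equiv.subtypeEquivRight fun a => by rw [hin j])
  have he : ∀ j, e j none = j := fun j => rfl
  rw [borderedDet_expand A _ x y e he, ← Finset.sum_coe_sort J]
  rfl

theorem pathSum_card [DecidableEq ι] (A : X → X → R) (θ : ι → X) (x y : X) (T : Finset ι) :
    pathSum A θ T.card x y T = (if T = ∅ then A x y else 0) +
      ∑ j ∈ T, A x (θ j) * pathSum A θ (T.erase j).card (θ j) y (T.erase j) := by
  rcases T.eq_empty_or_nonempty with rfl | hT
  · simp [pathSum]
  · obtain ⟨n, hn⟩ := Nat.exists_eq_succ_of_ne_zero hT.card_pos.ne'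
    rw [hn, if_neg hT.ne_empty, zero_add]
    simp only [pathSum]
    refine Finset.sum_congr rfl fun j hj => ?_
    rw [Finset.card_erase_of_mem hj, hn, Nat.succ_sub_one]

/-- Iterating the row expansion follows a path from `x` through the points of `T`. -/
theorem borderedDet_eq_sum_pathSum [DecidableEq ι] (A : X → X → R) (θ : ι → X) (x y : X)
    (J : Finset ι) :
    borderedDet A (fun a : J => θ a) x y = ∑ T ∈ J.powerset,
      (-1) ^ T.card * pathSum A θ T.card x y T *
        kernelDet A (fun a : (J \ T : Finset ι) => θ a) := by
  induction hn : J.card generalizing x J with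
  | zero =>
    obtain rfl := Finset.card_eq_zero.1 hn
    rw [borderedDet_erase, Finset.powerset_empty, Finset.sum_singleton, Finset.sdiff_empty]
    simp [pathSum]
  | succ n ih =>
    rw [borderedDet_erase]
    have h1 : ∀ T ∈ J.powerset, (-1) ^ T.card * pathSum A θ T.card x y T *
        kernelDet A (fun a : (J \ T : Finset ι) => θ a) =
        (if T = ∅ then A x y * kernelDet A (fun a : (J \ T : Finset ι) => θ a) else 0) -
        ∑ j ∈ T, A x (θ j) * ((-1) ^ (T.erase j).card *
          pathSum A θ (T.erase j).card (θ j) y (T.erase j) *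
            kernelDet A (fun a : (J \ T : Finset ι) => θ a)) := by
      intro T _
      rw [pathSum_card, mul_add, add_mul, sub_eq_add_neg, ← Finset.sum_neg_distrib, Finset.mul_sum,
        Finset.sum_mul]
      congr 1
      · split_ifs with h
        · simp [h]
        · simp
      · refine Finset.sum_congr rfl fun j hj => ?_
        rw [← Finset.card_erase_add_one hj, pow_succ]
        ring
    rw [Finset.sum_congr rfl h1, Finset.sum_sub_distrib, Finset.sum_ite_eq' J.powerset ∅,
      if_pos (Finset.empty_mem_powerset J)]
    congr 1
    · rw [Finset.sdiff_empty]
    · rw [Finset.sum_comm' (t' := J) (s' := fun j => (J.erase j).powerset.image (insert j))]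
      · refine Finset.sum_congr rfl fun j hj => ?_
        rw [ih (θ j) (J.erase j) (by rw [Finset.card_erase_of_mem hj, hn]; rfl), Finset.mul_sum,
          Finset.sum_image]
        · refine Finset.sum_congr rfl fun T hT => ?_
          have hjT : j ∉ T := fun h => by
            simpa using Finset.mem_powerset.1 hT h
          have : J \ insert j T = J.erase j \ T := by
            ext a; simp; tauto
          rw [Finset.erase_insert hjT, this]
        · intro S hS T hT hST
          have hjS : j ∉ S := fun h => by simpa using Finset.mem_powerset.1 hS h
          have hjT : j ∉ T := fun h => by simpa using Finset.mem_powerset.1 hT h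
          rw [← Finset.erase_insert hjS, ← Finset.erase_insert hjT]
          exact congrArg (Finset.erase · j) hST
      · intro T j
        simp only [Finset.mem_powerset, Finset.mem_image]
        constructor
        · rintro ⟨h1, h2⟩
          exact ⟨⟨T.erase j, Finset.erase_subset_erase j h1, Finset.insert_erase h2⟩, h1 h2⟩
        · rintro ⟨⟨S, hS, rfl⟩, hj⟩
          exact ⟨Finset.insert_subset hj (hS.trans (Finset.erase_subset _ _)),
            Finset.mem_insert_self _ _⟩

/-- The cycle expansion of a determinant, sorted by the cycle through the index `i`. -/
theorem kernelDet_insert [DecidableEq ι] (A : X → X → R) (θ : ι → X) {i : ι} {J : Finset ι}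
    (hi : i ∉ J) :
    kernelDet A (fun a : (insert i J : Finset ι) => θ a) = ∑ T ∈ J.powerset,
      (-1) ^ T.card * pathSum A θ T.card (θ i) (θ i) T *
        kernelDet A (fun a : (J \ T : Finset ι) => θ a) := by
  rw [← borderedDet_eq_sum_pathSum]
  exact (borderedDet_self_eq A (fun a : (insert i J : Finset ι) => θ a)
    (Finset.subtypeInsertEquivOption hi).symm).symm

/-- The set partitions of `insert i J`, sorted by the block `insert i T` of `i`. -/
theorem sum_finpartition_insert [DecidableEq ι] (K : Finset ι → R) {i : ι} {J : Finset ι}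
    (hi : i ∉ J) :
    ∑ π : Finpartition (insert i J), ∏ B ∈ π.parts, K B =
      ∑ T ∈ J.powerset, K (insert i T) * ∑ π : Finpartition (J \ T), ∏ B ∈ π.parts, K B := by
  simp_rw [Finset.mul_sum]
  rw [Finset.sum_sigma' J.powerset (fun T => (Finset.univ : Finset (Finpartition (J \ T))))
    (fun T π => K (insert i T) * ∏ B ∈ π.parts, K B)]
  have hbot : ∀ T : Finset ι, insert i T ≠ (⊥ : Finset ι) := fun T => Finset.insert_ne_empty i T
  have hdisj : ∀ T : Finset ι, Disjoint (J \ T) (insert i T) := by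
    intro T
    rw [Finset.disjoint_left]
    intro a ha ha'
    simp only [Finset.mem_sdiff, Finset.mem_insert] at ha ha'
    rcases ha' with rfl | h
    · exact hi ha.1
    · exact ha.2 h
  have hsup : ∀ T ∈ J.powerset, (J \ T) ⊔ insert i T = insert i J := by
    intro T hT
    ext a
    have : a ∈ T → a ∈ J := fun h => Finset.mem_powerset.1 hT h
    simp only [Finset.sup_eq_union, Finset.mem_union, Finset.mem_sdiff, Finset.mem_insert]
    tauto
  have hnotin : ∀ (T : Finset ι) (π : Finpartition (J \ T)), ∀ B ∈ π.parts, i ∉ B :=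
    fun T π B hB h => hi (Finset.mem_sdiff.1 (π.subset hB h)).1
  symm
  refine Finset.sum_bij (fun x hx => x.2.extend (hbot x.1) (hdisj x.1)
    (hsup x.1 (Finset.mem_sigma.1 hx).1)) (fun _ _ => Finset.mem_univ _) ?_ ?_ ?_
  · rintro ⟨T, π⟩ hT ⟨T', π'⟩ hT' heq
    have hT : T ⊆ J := Finset.mem_powerset.1 (Finset.mem_sigma.1 hT).1
    have hT' : T' ⊆ J := Finset.mem_powerset.1 (Finset.mem_sigma.1 hT').1
    have hp : insert (insert i T) π.parts = insert (insert i T') π'.parts :=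
      congrArg Finpartition.parts heq
    have h1 : insert i T = insert i T' := by
      have : insert i T ∈ insert (insert i T') π'.parts := hp ▸ Finset.mem_insert_self _ _
      rcases Finset.mem_insert.1 this with h | h
      · exact h
      · exact absurd (Finset.mem_insert_self i T) (hnotin _ _ _ h)
    obtain rfl : T = T' := by
      rw [← Finset.erase_insert (fun h => hi (hT h)), h1,
        Finset.erase_insert (fun h => hi (hT' h))]
    have h2 : ∀ π : Finpartition (J \ T), insert i T ∉ π.parts := fun π h =>
      hnotin _ _ _ h (Finset.mem_insert_self i T)
    obtain rfl : π = π' := by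
      apply Finpartition.ext
      rw [← Finset.erase_insert (h2 π), hp, Finset.erase_insert (h2 π')]
    rfl
  · intro π _
    have hmem : i ∈ π.part i := π.mem_part_self.2 (Finset.mem_insert_self i J)
    have hpart : π.part i ∈ π.parts := π.part_mem.2 (Finset.mem_insert_self i J)
    set T := (π.part i).erase i with hTdef
    have hins : insert i T = π.part i := Finset.insert_erase hmem
    have hTJ : T ⊆ J := by
      intro a ha
      have := π.subset hpart (Finset.mem_of_mem_erase ha)
      exact (Finset.mem_insert.1 this).resolve_left (Finset.ne_of_mem_erase ha)
    have hsd : (π.parts.erase (π.part i)).sup id = J \ T := by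
      ext a
      simp only [Finset.mem_sup, Finset.mem_erase, id, Finset.mem_sdiff]
      constructor
      · rintro ⟨B, ⟨hB1, hB2⟩, haB⟩
        have hai : a ∉ π.part i := fun h => hB1 (π.eq_of_mem_parts hB2 hpart haB h)
        refine ⟨(Finset.mem_insert.1 (π.subset hB2 haB)).resolve_left ?_, ?_⟩
        · rintro rfl; exact hai hmem
        · exact fun h => hai (Finset.mem_of_mem_erase h)
      · rintro ⟨haJ, haT⟩
        obtain ⟨B, hB, haB⟩ := π.exists_mem (Finset.mem_insert_of_mem (b := i) haJ)
        refine ⟨B, ⟨?_, hB⟩, haB⟩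
        rintro rfl
        exact haT (Finset.mem_erase.2 ⟨fun h => hi (h ▸ haJ), haB⟩)
    refine ⟨⟨T, (π.ofSubset (Finset.erase_subset (π.part i) π.parts) hsd)⟩, ?_, ?_⟩
    · exact Finset.mem_sigma.2 ⟨Finset.mem_powerset.2 hTJ, Finset.mem_univ _⟩
    · apply Finpartition.ext
      change insert (insert i T) (π.parts.erase (π.part i)) = π.parts
      rw [hins, Finset.insert_erase hpart]
  · rintro ⟨T, π⟩ hT
    change _ = ∏ B ∈ insert (insert i T) π.parts, K B
    rw [Finset.prod_insert]
    exact fun h => hnotin _ _ _ h (Finset.mem_insert_self i T)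

/-- The connected part of a determinant: the sum over the cyclic permutations of the index set
`S`, with their sign. The cycles are cut open at the largest index. The value `1` on the empty set
plays no role, since the blocks of a set partition are nonempty. -/
def cycleSum {ι : Type*} [LinearOrder ι] (A : X → X → R) (θ : ι → X) (S : Finset ι) : R :=
  if hS : S.Nonempty then
    (-1) ^ (S.erase (S.max' hS)).card *
      pathSum A θ (S.erase (S.max' hS)).card (θ (S.max' hS)) (θ (S.max' hS)) (S.erase (S.max' hS))
  else 1

theorem max'_insert_of_lt {ι : Type*} [LinearOrder ι] {i : ι} {T : Finset ι}
    (hi : ∀ j ∈ T, j < i) : (insert i T).max' (Finset.insert_nonempty i T) = i := by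
  apply le_antisymm
  · refine Finset.max'_le _ _ _ fun j hj => ?_
    rcases Finset.mem_insert.1 hj with rfl | h
    · exact le_rfl
    · exact (hi j h).le
  · exact Finset.le_max' _ _ (Finset.mem_insert_self i T)

theorem cycleSum_insert {ι : Type*} [LinearOrder ι] (A : X → X → R) (θ : ι → X) {i : ι}
    {T : Finset ι} (hi : ∀ j ∈ T, j < i) :
    cycleSum A θ (insert i T) = (-1) ^ T.card * pathSum A θ T.card (θ i) (θ i) T := by
  have hiT : i ∉ T := fun h => lt_irrefl _ (hi i h)
  rw [cycleSum, dif_pos (Finset.insert_nonempty i T)]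
  simp only [max'_insert_of_lt hi, Finset.erase_insert hiT]

/-- The cycle decomposition of permutations, as an identity for determinants. -/
theorem kernelDet_eq_sum_finpartition {ι : Type*} [LinearOrder ι] (A : X → X → R) (θ : ι → X)
    (J : Finset ι) :
    kernelDet A (fun a : J => θ a) = ∑ π : Finpartition J, ∏ B ∈ π.parts, cycleSum A θ B := by
  induction hn : J.card using Nat.strong_induction_on generalizing J with
  | _ n ih =>
  rcases J.eq_empty_or_nonempty with rfl | hJ
  · have hp : ∀ π : Finpartition (∅ : Finset ι), π.parts = ∅ :=
      fun π => Finpartition.parts_eq_empty_iff.2 rfl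
    have hu : Fintype.card (Finpartition (∅ : Finset ι)) = 1 :=
      Fintype.card_eq_one_iff.2 ⟨Finpartition.empty _, fun π => Finpartition.ext (hp π)⟩
    simp only [hp, Finset.prod_empty, Finset.sum_const, Finset.card_univ, hu]
    simp [kernelDet]
  · obtain ⟨i, T, hi, rfl⟩ : ∃ i T, (∀ j ∈ T, j < i) ∧ J = insert i T :=
      ⟨J.max' hJ, J.erase (J.max' hJ), fun j hj => Finset.lt_max'_of_mem_erase_max' _ hJ hj,
        (Finset.insert_erase (J.max'_mem hJ)).symm⟩
    have hiT : i ∉ T := fun h => lt_irrefl _ (hi i h)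
    rw [kernelDet_insert A θ hiT, sum_finpartition_insert _ hiT]
    refine Finset.sum_congr rfl fun S hS => ?_
    have hS' := Finset.mem_powerset.1 hS
    rw [cycleSum_insert A θ fun j hj => hi j (hS' hj)]
    congr 1
    refine ih (T \ S).card ?_ (T \ S) rfl
    rw [← hn, Finset.card_insert_of_notMem hiT]
    exact Nat.lt_succ_of_le (Finset.card_le_card Finset.sdiff_subset)

end Algebra

/-! ### The form factors and the kernel `sech` -/

section Kernel

/-- The difference kernel `sech (x / 2) / (2π)`. -/
noncomputable def kern (x : ℝ) : ℝ := (2 * Real.pi)⁻¹ * (Real.cosh (x / 2))⁻¹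

theorem kern_pos (x : ℝ) : 0 < kern x := by
  have := Real.cosh_pos (x / 2)
  unfold kern
  positivity

theorem kern_neg (x : ℝ) : kern (-x) = kern x := by
  rw [kern, neg_div, Real.cosh_neg, kern]

theorem kern_le (x : ℝ) : kern x ≤ (2 * Real.pi)⁻¹ := by
  have h1 := Real.one_le_cosh (x / 2)
  unfold kern
  exact mul_le_of_le_one_right (by positivity) (inv_le_one_of_one_le₀ h1)

theorem continuous_kern : Continuous kern := by
  unfold kern
  exact continuous_const.mul ((Real.continuous_cosh.comp (by fun_prop)).inv₀
    fun x => (Real.cosh_pos _).ne')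

/-- One step of Gaussian elimination turns the kernel `sech` into
`sech (a - b) - sech a * sech b = tanh a * tanh b * sech (a - b)`. -/
theorem sech_sub_sub (a b : ℝ) :
    (Real.cosh (a - b))⁻¹ = Real.tanh a * Real.tanh b * (Real.cosh (a - b))⁻¹ +
      (Real.cosh a)⁻¹ * (Real.cosh b)⁻¹ := by
  have ha := (Real.cosh_pos a).ne'
  have hb := (Real.cosh_pos b).ne'
  have hab := (Real.cosh_pos (a - b)).ne'
  rw [Real.tanh_eq_sinh_div_cosh, Real.tanh_eq_sinh_div_cosh]
  field_simp
  rw [Real.cosh_sub]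
  ring

/-- A special case of Cauchy's determinant. -/
theorem det_sech (n : ℕ) (θ : Fin n → ℝ) :
    (Matrix.of fun i j => (Real.cosh ((θ i - θ j) / 2))⁻¹).det =
      ∏ i : Fin n, ∏ j ∈ Finset.Ioi i, Real.tanh ((θ i - θ j) / 2) ^ 2 := by
  induction n with
  | zero => simp
  | succ n ih =>
    rw [Fin.prod_univ_succ, Fin.prod_Ioi_zero]
    simp only [Fin.prod_Ioi_succ]
    rw [← ih fun i => θ i.succ]
    -- `B` is the matrix after clearing the first column with the help of the first row
    set t : Fin n → ℝ := fun i => Real.tanh ((θ i.succ - θ 0) / 2) with ht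
    let B : Matrix (Fin (n + 1)) (Fin (n + 1)) ℝ := Matrix.of fun i j =>
      Fin.cases (motive := fun _ => ℝ) (Real.cosh ((θ 0 - θ j) / 2))⁻¹
        (fun i => Fin.cases (motive := fun _ => ℝ) 0
          (fun j => t i * t j * (Real.cosh ((θ i.succ - θ j.succ) / 2))⁻¹) j) i
    have hB : (Matrix.of fun i j => (Real.cosh ((θ i - θ j) / 2))⁻¹).det = B.det := by
      refine Matrix.det_eq_of_forall_row_eq_smul_add_const
        (Fin.cases (motive := fun _ => ℝ) 0 fun i => (Real.cosh ((θ i.succ - θ 0) / 2))⁻¹) 0 rfl ?_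
      intro i j
      refine Fin.cases ?_ (fun i => ?_) i
      · simp [B]
      · refine Fin.cases ?_ (fun j => ?_) j
        · simp [B]
        · have h1 : (θ i.succ - θ j.succ) / 2 =
              (θ i.succ - θ 0) / 2 - (θ j.succ - θ 0) / 2 := by ring
          have h2 : (θ 0 - θ j.succ) / 2 = -((θ j.succ - θ 0) / 2) := by ring
          simp only [B, Matrix.of_apply, Fin.cases_succ, Fin.cases_zero, ht]
          rw [h2, Real.cosh_neg, h1]
          exact sech_sub_sub _ _
    rw [hB, Matrix.det_succ_column_zero, Fin.sum_univ_succ]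
    have hsub : B.submatrix (Fin.succAbove 0) Fin.succ = Matrix.of fun i j =>
        t i * (Matrix.of fun i j =>
          t j * (Matrix.of fun i j => (Real.cosh ((θ i.succ - θ j.succ) / 2))⁻¹) i j) i j := by
      ext i j
      simp [B, mul_assoc]
    rw [hsub, Matrix.det_mul_column, Matrix.det_mul_row]
    have hprod : ∏ i : Fin n, Real.tanh ((θ 0 - θ i.succ) / 2) ^ 2 = (∏ i, t i) * ∏ i, t i := by
      rw [← Finset.prod_mul_distrib]
      refine Finset.prod_congr rfl fun i _ => ?_
      have h2 : (θ 0 - θ i.succ) / 2 = -((θ i.succ - θ 0) / 2) := by ring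
      rw [h2, Real.tanh_neg, neg_sq, sq]
    rw [hprod]
    simp [B, mul_assoc]

theorem kernelDet_kern (n : ℕ) (θ : Fin n → ℝ) :
    kernelDet (fun x y => kern (x - y)) θ = ((2 * Real.pi) ^ n)⁻¹ *
      ∏ i : Fin n, ∏ j ∈ Finset.Ioi i, Real.tanh ((θ i - θ j) / 2) ^ 2 := by
  rw [← det_sech]
  have : (Matrix.of fun i j => kern (θ i - θ j)) =
      (2 * Real.pi)⁻¹ • Matrix.of fun i j => (Real.cosh ((θ i - θ j) / 2))⁻¹ := by
    ext i j; simp [kern]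
  rw [kernelDet, this, Matrix.det_smul, Fintype.card_fin, inv_pow]

theorem g_eq (n : ℕ) (θ : Fin n → ℝ) : g n θ = ((2 * Real.pi) ^ n)⁻¹ *
    ∏ i : Fin n, ∏ j ∈ Finset.Ioi i, Real.tanh ((θ i - θ j) / 2) ^ 2 := by
  have h2 : ‖(2 * Complex.I : ℂ)‖ = 2 := by simp
  have hnorm : ‖formFactor n θ‖ ^ 2 = 2 ^ n * tanhProd n θ ^ 2 := by
    unfold formFactor formFactorMu formFactorSigma
    rcases Nat.even_or_odd n with hn | hn
    · have hn' : ¬ Odd n := Nat.not_odd_iff_even.2 hn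
      obtain ⟨k, rfl⟩ := hn
      rw [if_pos ⟨k, rfl⟩, if_neg hn', mul_zero, add_zero, norm_mul, norm_pow, h2,
        Complex.norm_real, Real.norm_eq_abs, mul_pow, sq_abs, ← pow_mul,
        show (k + k) / 2 * 2 = k + k by omega]
    · have hn' : ¬ Even n := Nat.not_even_iff_odd.2 hn
      have hs : ‖(2 * Complex.I : ℂ) ^ (1 / 2 : ℂ)‖ ^ 2 = 2 := by
        rw [← norm_pow, ← Complex.cpow_nat_mul]
        norm_num
      rw [if_pos hn, if_neg hn', zero_add, norm_mul, norm_mul, norm_pow, h2,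
        Complex.norm_real, Real.norm_eq_abs, mul_pow, mul_pow, sq_abs, ← pow_mul, hs]
      obtain ⟨k, rfl⟩ := hn
      rw [show (2 * k + 1 - 1) / 2 * 2 = 2 * k by omega, pow_succ]
      ring
  rw [g, hnorm, tanhProd, ← Finset.prod_pow]
  simp_rw [← Finset.prod_pow]
  rw [← mul_assoc]
  congr 1
  rw [show (4 * Real.pi) = 2 * (2 * Real.pi) by ring, mul_pow, mul_inv, mul_comm, ← mul_assoc,
    mul_inv_cancel₀ (by positivity), one_mul]

theorem g_eq_kernelDet (n : ℕ) (θ : Fin n → ℝ) :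
    g n θ = kernelDet (fun x y => kern (x - y)) θ := by
  rw [g_eq, kernelDet_kern]

theorem cycleSum_restrict {n : ℕ} (A : ℝ → ℝ → ℝ) (θ : Fin n → ℝ) {B : Finset (Fin n)}
    (hB : B.Nonempty) :
    cycleSum A (restrict θ B) Finset.univ = cycleSum A θ B := by
  obtain ⟨i, hi⟩ : ∃ i, B.orderEmbOfFin rfl i = B.max' hB :=
    ⟨_, Finset.orderEmbOfFin_last rfl hB.card_pos⟩
  set e := B.orderEmbOfFin rfl
  have himg : Finset.univ.map e.toEmbedding = B := Finset.map_orderEmbOfFin_univ B rfl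
  have hlt : ∀ j ∈ Finset.univ.erase i, j < i := by
    intro j hj
    rw [← e.lt_iff_lt, hi]
    refine lt_of_le_of_ne (Finset.le_max' _ _ (Finset.orderEmbOfFin_mem B rfl j)) ?_
    rw [← hi]
    exact fun h => Finset.ne_of_mem_erase hj (e.injective h)
  have h1 : cycleSum A (restrict θ B) (insert i (Finset.univ.erase i)) =
      cycleSum A θ (insert (e i) ((Finset.univ.erase i).map e.toEmbedding)) := by
    rw [cycleSum_insert A _ hlt, cycleSum_insert, pathSum_map, Finset.card_map]
    · rfl
    · intro j hj
      obtain ⟨k, hk, rfl⟩ := Finset.mem_map.1 hj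
      exact e.lt_iff_lt.2 (hlt k hk)
  rw [Finset.insert_erase (Finset.mem_univ i), Finset.map_erase, himg] at h1
  rw [h1]
  congr 1
  exact Finset.insert_erase (Finset.orderEmbOfFin_mem B rfl i)

theorem kernelDet_univ {n : ℕ} (A : ℝ → ℝ → ℝ) (θ : Fin n → ℝ) :
    kernelDet A (fun a : (Finset.univ : Finset (Fin n)) => θ a) = kernelDet A θ :=
  kernelDet_equiv A θ (Equiv.subtypeUnivEquiv fun i => Finset.mem_univ i)

/-- The cumulants of the determinants `gₙ` are the sums over cyclic permutations: both solve the
same recursion over set partitions, which determines the term of the one-block partition. -/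
theorem h_eq_cycleSum (n : ℕ) (hn : 0 < n) (θ : Fin n → ℝ) :
    h n θ = cycleSum (fun x y => kern (x - y)) θ Finset.univ := by
  induction n using Nat.strong_induction_on with
  | _ n ih =>
  classical
  have hne : (Finset.univ : Finset (Fin n)) ≠ ⊥ := by
    have : Nonempty (Fin n) := ⟨⟨0, hn⟩⟩
    exact Finset.univ_nonempty.ne_empty
  have h1 := g_eq_sum_h n θ
  rw [g_eq_kernelDet, ← kernelDet_univ, kernelDet_eq_sum_finpartition,
    ← Finset.add_sum_erase _ _ (Finset.mem_univ (Finpartition.indiscrete hne)),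
    ← Finset.add_sum_erase _ _ (Finset.mem_univ (Finpartition.indiscrete hne)),
    Finpartition.indiscrete_parts, Finset.prod_singleton, Finset.prod_singleton, h_card_univ] at h1
  have h2 : ∑ π ∈ Finset.univ.erase (Finpartition.indiscrete hne),
        ∏ B ∈ π.parts, cycleSum (fun x y => kern (x - y)) θ B =
      ∑ π ∈ Finset.univ.erase (Finpartition.indiscrete hne),
        ∏ B ∈ π.parts, h B.card (restrict θ B) := by
    refine Finset.sum_congr rfl fun π hπ => Finset.prod_congr rfl fun B hB => ?_
    have hBne := π.nonempty_of_mem_parts hB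
    have hBu : B ≠ Finset.univ := by
      rintro rfl
      refine Finset.ne_of_mem_erase hπ ?_
      ext C
      rw [Finpartition.indiscrete_parts, Finset.mem_singleton]
      constructor
      · intro hC
        obtain ⟨x, hx⟩ := π.nonempty_of_mem_parts hC
        exact π.eq_of_mem_parts hC hB hx (Finset.mem_univ x)
      · rintro rfl; exact hB
    have hcard : B.card < n := by
      simpa using Finset.card_lt_card (Finset.ssubset_univ_iff.2 hBu)
    rw [ih B.card hcard hBne.card_pos, cycleSum_restrict _ _ hBne]
  rw [h2] at h1
  exact (add_right_cancel h1).symm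

theorem h_snoc (n : ℕ) (θ : Fin n → ℝ) :
    h (n + 1) (Fin.snoc (α := fun _ => ℝ) θ 0) =
      (-1) ^ n * pathSum (fun x y => kern (x - y)) θ n 0 0 Finset.univ := by
  have huniv : (Finset.univ : Finset (Fin (n + 1))) =
      insert (Fin.last n) (Finset.univ.map Fin.castSuccEmb) := by
    ext i
    refine Fin.lastCases ?_ (fun j => ?_) i <;> simp
  rw [h_eq_cycleSum (n + 1) n.succ_pos, huniv, cycleSum_insert, pathSum_map, Finset.card_map,
    Finset.card_univ, Fintype.card_fin, Fin.snoc_last]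
  · congr 2
    funext k
    exact Fin.snoc_castSucc (α := fun _ => ℝ) 0 θ k
  · intro j hj
    obtain ⟨k, _, rfl⟩ := Finset.mem_map.1 hj
    exact Fin.castSucc_lt_last k

end Kernel

/-! ### The Fourier transform of `sech` -/

section Fourier

/-- The integrand of Euler's Beta integral at `(1/2 + iκ, 1/2 - iκ)`, in the logistic variable. -/
theorem beta_integrand_sigmoid (κ t : ℝ) :
    |t.sigmoid * (1 - t.sigmoid)| • ((t.sigmoid : ℂ) ^ ((1 / 2 + κ * Complex.I : ℂ) - 1) *
      (1 - (t.sigmoid : ℂ)) ^ ((1 / 2 - κ * Complex.I : ℂ) - 1)) =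
    (Real.pi * kern t : ℝ) * Complex.exp ((κ * t : ℝ) * Complex.I) := by
  have h0 := t.sigmoid_pos
  have h1 : 0 < 1 - t.sigmoid := sub_pos.2 t.sigmoid_lt_one
  have e1 : t.sigmoid = Real.exp (t / 2) / (2 * Real.cosh (t / 2)) := by
    rw [Real.sigmoid_def, Real.cosh_eq, show -t = -(t / 2) + -(t / 2) by ring, Real.exp_add,
      Real.exp_neg]
    have := (Real.exp_pos (t / 2)).ne'
    field_simp
  have e2 : 1 - t.sigmoid = Real.exp (-(t / 2)) / (2 * Real.cosh (t / 2)) := by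
    rw [e1, Real.cosh_eq]
    have := (Real.exp_pos (t / 2)).ne'
    have := (Real.exp_pos (-(t / 2))).ne'
    have h3 : (Real.exp (t / 2) + Real.exp (-(t / 2))) ≠ 0 := by positivity
    field_simp
    ring
  have hc := Real.cosh_pos (t / 2)
  have l1 : Real.log t.sigmoid = t / 2 - Real.log (2 * Real.cosh (t / 2)) := by
    rw [e1, Real.log_div (Real.exp_pos _).ne' (by positivity), Real.log_exp]
  have l2 : Real.log (1 - t.sigmoid) = -(t / 2) - Real.log (2 * Real.cosh (t / 2)) := by
    rw [e2, Real.log_div (Real.exp_pos _).ne' (by positivity), Real.log_exp]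
  have c1 : ((1 : ℂ) - (t.sigmoid : ℂ)) = ((1 - t.sigmoid : ℝ) : ℂ) := by push_cast; rfl
  rw [abs_of_pos (mul_pos h0 h1), c1, Complex.cpow_def_of_ne_zero (by exact_mod_cast h0.ne'),
    Complex.cpow_def_of_ne_zero (by exact_mod_cast h1.ne'), ← Complex.ofReal_log h0.le,
    ← Complex.ofReal_log h1.le, ← Complex.exp_add, l1, l2, Complex.real_smul]
  have e3 : t.sigmoid * (1 - t.sigmoid) = ((2 * Real.cosh (t / 2))⁻¹) ^ 2 := by
    rw [e2, e1, div_mul_div_comm, ← Real.exp_add]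
    simp [sq]
  have e4 : Complex.exp (Real.log (2 * Real.cosh (t / 2))) = (2 * Real.cosh (t / 2) : ℝ) := by
    rw [← Complex.ofReal_exp, Real.exp_log (by positivity)]
  have e5 : ((t / 2 - Real.log (2 * Real.cosh (t / 2)) : ℝ) : ℂ) * (1 / 2 + κ * Complex.I - 1) +
      ((-(t / 2) - Real.log (2 * Real.cosh (t / 2)) : ℝ) : ℂ) * (1 / 2 - κ * Complex.I - 1) =
      Real.log (2 * Real.cosh (t / 2)) + (κ * t : ℝ) * Complex.I := by
    push_cast; ring
  rw [e3, e5, Complex.exp_add, e4, ← mul_assoc, ← Complex.ofReal_mul]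
  congr 2
  unfold kern
  field_simp

theorem integrable_exp_kern (κ : ℝ) : Integrable fun t : ℝ =>
    ((Real.pi * kern t : ℝ) : ℂ) * Complex.exp ((κ * t : ℝ) * Complex.I) := by
  have hu : 0 < ((1 / 2 + κ * Complex.I : ℂ)).re := by simp
  have hv : 0 < ((1 / 2 - κ * Complex.I : ℂ)).re := by simp
  have h1 := Complex.betaIntegral_convergent hu hv
  rw [intervalIntegrable_iff_integrableOn_Ioo_of_le zero_le_one, ← Real.range_sigmoid,
    ← Set.image_univ, integrableOn_image_iff_integrableOn_abs_deriv_smul MeasurableSet.univ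
      (fun x _ => (Real.hasDerivAt_sigmoid x).hasDerivWithinAt)
      Real.sigmoid_injective.injOn, integrableOn_univ] at h1
  simpa only [beta_integrand_sigmoid] using h1

/-- The Fourier transform of the kernel, from Euler's Beta integral and the reflection formula. -/
theorem integral_exp_kern (κ : ℝ) :
    ∫ t : ℝ, ((Real.pi * kern t : ℝ) : ℂ) * Complex.exp ((κ * t : ℝ) * Complex.I) =
      ((Real.pi * (Real.cosh (Real.pi * κ))⁻¹ : ℝ) : ℂ) := by
  have hu : 0 < ((1 / 2 + κ * Complex.I : ℂ)).re := by simp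
  have hv : 0 < ((1 / 2 - κ * Complex.I : ℂ)).re := by simp
  have h1 : Complex.betaIntegral (1 / 2 + κ * Complex.I) (1 / 2 - κ * Complex.I) =
      ∫ t : ℝ, ((Real.pi * kern t : ℝ) : ℂ) * Complex.exp ((κ * t : ℝ) * Complex.I) := by
    rw [Complex.betaIntegral, intervalIntegral.integral_of_le zero_le_one,
      integral_Ioc_eq_integral_Ioo, ← Real.range_sigmoid, ← Set.image_univ,
      integral_image_eq_integral_abs_deriv_smul MeasurableSet.univ
        (fun x _ => (Real.hasDerivAt_sigmoid x).hasDerivWithinAt)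
        Real.sigmoid_injective.injOn, setIntegral_univ]
    simp only [beta_integrand_sigmoid]
  rw [← h1, Complex.betaIntegral_eq_Gamma_mul_div _ _ hu hv,
    show (1 / 2 - κ * Complex.I : ℂ) = 1 - (1 / 2 + κ * Complex.I) by ring,
    Complex.Gamma_mul_Gamma_one_sub, add_sub_cancel, Complex.Gamma_one, div_one, mul_add,
    show (Real.pi : ℂ) * (1 / 2) = Real.pi / 2 by ring, add_comm, Complex.sin_add_pi_div_two,
    ← mul_assoc, Complex.cos_mul_I, ← Complex.ofReal_mul, ← Complex.ofReal_cosh, div_eq_mul_inv]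
  push_cast
  rfl

theorem integrable_kern : Integrable kern := by
  have h := ((integrable_exp_kern 0).re).const_mul Real.pi⁻¹
  refine h.congr (ae_of_all _ fun t => ?_)
  simp

theorem integral_kern_mul_cos (κ : ℝ) :
    ∫ t, kern t * Real.cos (κ * t) = (Real.cosh (Real.pi * κ))⁻¹ := by
  have h := congrArg Complex.re (integral_exp_kern κ)
  rw [← RCLike.re_eq_complex_re, ← integral_re (integrable_exp_kern κ)] at h
  simp only [RCLike.re_eq_complex_re, Complex.re_ofReal_mul, Complex.exp_ofReal_mul_I_re,
    Complex.ofReal_re, mul_assoc, integral_const_mul] at h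
  exact mul_left_cancel₀ Real.pi_ne_zero h

theorem integral_kern_mul_sin (κ : ℝ) : ∫ t, kern t * Real.sin (κ * t) = 0 := by
  have h := integral_neg_eq_self (fun t => kern t * Real.sin (κ * t)) volume
  simp only [kern_neg, mul_neg, Real.sin_neg, integral_neg] at h
  linarith

theorem integral_kern : ∫ t, kern t = 1 := by
  simpa using integral_kern_mul_cos 0

theorem integrable_kern_sub (x : ℝ) : Integrable fun t => kern (x - t) :=
  integrable_kern.comp_sub_left x

theorem integral_kern_sub (x : ℝ) : ∫ t, kern (x - t) = 1 := by
  rw [integral_sub_left_eq_self kern volume x, integral_kern]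

theorem integral_kern_sub_mul_cos (κ x y : ℝ) :
    ∫ t, kern (x - t) * Real.cos (κ * (t - y)) =
      (Real.cosh (Real.pi * κ))⁻¹ * Real.cos (κ * (x - y)) := by
  have h1 : ∀ t, kern (x - t) * Real.cos (κ * (t - y)) =
      (fun u => kern u * Real.cos (κ * u) * Real.cos (κ * (x - y)) +
        kern u * Real.sin (κ * u) * Real.sin (κ * (x - y))) (x - t) := by
    intro t
    have : κ * (t - y) = κ * (x - y) - κ * (x - t) := by ring
    simp only [this, Real.cos_sub]
    ring
  have hc : Integrable fun u => kern u * Real.cos (κ * u) :=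
    integrable_kern.mul_bdd (c := 1) (by fun_prop) (ae_of_all _ fun u => Real.abs_cos_le_one _)
  have hs : Integrable fun u => kern u * Real.sin (κ * u) :=
    integrable_kern.mul_bdd (c := 1) (by fun_prop) (ae_of_all _ fun u => Real.abs_sin_le_one _)
  simp_rw [h1]
  rw [integral_sub_left_eq_self (fun u => kern u * Real.cos (κ * u) * Real.cos (κ * (x - y)) +
        kern u * Real.sin (κ * u) * Real.sin (κ * (x - y))) volume x,
    integral_add (hc.mul_const _) (hs.mul_const _), integral_mul_const, integral_mul_const,
    integral_kern_mul_cos, integral_kern_mul_sin, zero_mul, add_zero]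

theorem sech_eq_kern (k : ℝ) :
    (Real.cosh (Real.pi * k))⁻¹ = 2 * Real.pi * kern (2 * Real.pi * k) := by
  rw [kern, show 2 * Real.pi * k / 2 = Real.pi * k by ring, ← mul_assoc,
    mul_inv_cancel₀ (by positivity), one_mul]

theorem integrable_sech_pi : Integrable fun k : ℝ => (Real.cosh (Real.pi * k))⁻¹ := by
  simp_rw [sech_eq_kern]
  exact (integrable_kern.comp_mul_left' (by positivity)).const_mul _

/-- The kernel is, up to scaling, its own Fourier transform. -/
theorem kern_eq_integral (x : ℝ) :
    kern x = (2 * Real.pi)⁻¹ * ∫ k, (Real.cosh (Real.pi * k))⁻¹ * Real.cos (k * x) := by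
  have h1 : ∀ k : ℝ, (Real.cosh (Real.pi * k))⁻¹ * Real.cos (k * x) =
      2 * Real.pi * (fun u => kern u * Real.cos (x / (2 * Real.pi) * u)) (2 * Real.pi * k) := by
    intro k
    rw [sech_eq_kern]
    have : x / (2 * Real.pi) * (2 * Real.pi * k) = k * x := by field_simp
    simp only [this]
    ring
  rw [integral_congr_ae (ae_of_all _ h1), integral_const_mul, Measure.integral_comp_mul_left
    (fun u => kern u * Real.cos (x / (2 * Real.pi) * u)) (2 * Real.pi), integral_kern_mul_cos, kern,
    abs_of_pos (by positivity), smul_eq_mul, ← mul_assoc (2 * Real.pi),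
    mul_inv_cancel₀ (by positivity), one_mul,
    show Real.pi * (x / (2 * Real.pi)) = x / 2 by field_simp]

end Fourier

/-! ### Iterated kernels and the integrals of the cumulants -/

section IteratedKernels

/-- The difference kernel `kern (x - y)` damped by the weight `ρ x`. Attaching the weight to one
argument only does not change determinants and traces, and it makes `ρ` a factor of each row. -/
noncomputable def wKernel (ρ : ℝ → ℝ) (x y : ℝ) : ℝ := ρ x * kern (x - y)

theorem wKernel_one : wKernel (fun _ => 1) = fun x y => kern (x - y) := by
  funext x y
  rw [wKernel, one_mul]

/-- The iterated kernels: `iterKernel A n` is the integral kernel of the power `n + 1` of the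
integral operator with kernel `A`. -/
noncomputable def iterKernel (A : ℝ → ℝ → ℝ) : ℕ → ℝ → ℝ → ℝ
  | 0, x, y => A x y
  | n + 1, x, y => ∫ t, A x t * iterKernel A n t y

/-- Damping weights: measurable, with values in `[0, 1]`. -/
structure IsWeight (ρ : ℝ → ℝ) : Prop where
  measurable : Measurable ρ
  nonneg : ∀ x, 0 ≤ ρ x
  le_one : ∀ x, ρ x ≤ 1

theorem isWeight_one : IsWeight fun _ => 1 :=
  ⟨measurable_const, fun _ => zero_le_one, fun _ => le_rfl⟩

variable {ρ : ℝ → ℝ}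

theorem IsWeight.measurable_wKernel (hρ : IsWeight ρ) :
    Measurable fun p : ℝ × ℝ => wKernel ρ p.1 p.2 :=
  (hρ.measurable.comp measurable_fst).mul
    (continuous_kern.measurable.comp (measurable_fst.sub measurable_snd))

theorem IsWeight.wKernel_nonneg (hρ : IsWeight ρ) (x y : ℝ) : 0 ≤ wKernel ρ x y :=
  mul_nonneg (hρ.nonneg x) (kern_pos _).le

theorem IsWeight.wKernel_le_kern (hρ : IsWeight ρ) (x y : ℝ) : wKernel ρ x y ≤ kern (x - y) :=
  mul_le_of_le_one_left (kern_pos _).le (hρ.le_one x)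

theorem integrable_wKernel (ρ : ℝ → ℝ) (x : ℝ) :
    Integrable fun t => wKernel ρ x t :=
  (integrable_kern_sub x).const_mul _

theorem integral_wKernel (x : ℝ) : ∫ t, wKernel ρ x t = ρ x := by
  simp_rw [wKernel]
  rw [integral_const_mul, integral_kern_sub, mul_one]

theorem measurable_iterKernel {A : ℝ → ℝ → ℝ} (hA : Measurable fun p : ℝ × ℝ => A p.1 p.2)
    (n : ℕ) : Measurable fun p : ℝ × ℝ => iterKernel A n p.1 p.2 := by
  induction n with
  | zero => exact hA
  | succ n ih =>
    have h1 : Measurable fun q : (ℝ × ℝ) × ℝ => A q.1.1 q.2 * iterKernel A n q.2 q.1.2 :=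
      (hA.comp (by fun_prop : Measurable fun q : (ℝ × ℝ) × ℝ => (q.1.1, q.2))).mul
        (ih.comp (by fun_prop : Measurable fun q : (ℝ × ℝ) × ℝ => (q.2, q.1.2)))
    exact (h1.stronglyMeasurable.integral_prod_right').measurable

theorem IsWeight.iterKernel_nonneg (hρ : IsWeight ρ) (n : ℕ) (x y : ℝ) :
    0 ≤ iterKernel (wKernel ρ) n x y := by
  induction n generalizing x with
  | zero => exact hρ.wKernel_nonneg x y
  | succ n ih => exact integral_nonneg fun t => mul_nonneg (hρ.wKernel_nonneg x t) (ih t)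

theorem IsWeight.measurable_iterKernel_left (hρ : IsWeight ρ) (n : ℕ) (y : ℝ) :
    Measurable fun t => iterKernel (wKernel ρ) n t y :=
  (measurable_iterKernel hρ.measurable_wKernel n).comp (by fun_prop : Measurable fun t => (t, y))

theorem IsWeight.iterKernel_le (hρ : IsWeight ρ) (n : ℕ) (x y : ℝ) :
    iterKernel (wKernel ρ) n x y ≤ (2 * Real.pi)⁻¹ := by
  induction n generalizing x with
  | zero => exact (hρ.wKernel_le_kern x y).trans (kern_le _)
  | succ n ih =>
    have hpi : 0 ≤ (2 * Real.pi)⁻¹ := by positivity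
    calc ∫ t, wKernel ρ x t * iterKernel (wKernel ρ) n t y
        ≤ ∫ t, wKernel ρ x t * (2 * Real.pi)⁻¹ := by
          refine integral_mono_of_nonneg
            (ae_of_all _ fun t => mul_nonneg (hρ.wKernel_nonneg x t) (hρ.iterKernel_nonneg n t y))
            ((integrable_wKernel ρ x).mul_const _)
            (ae_of_all _ fun t => mul_le_mul_of_nonneg_left (ih t) (hρ.wKernel_nonneg x t))
      _ ≤ (2 * Real.pi)⁻¹ := by
          rw [integral_mul_const, integral_wKernel]
          exact mul_le_of_le_one_left hpi (hρ.le_one x)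

theorem IsWeight.integrable_wKernel_mul_iterKernel (hρ : IsWeight ρ) (n : ℕ) (x y : ℝ) :
    Integrable fun t => wKernel ρ x t * iterKernel (wKernel ρ) n t y :=
  (integrable_wKernel ρ x).mul_bdd (c := (2 * Real.pi)⁻¹)
    (hρ.measurable_iterKernel_left n y).aestronglyMeasurable
    (ae_of_all _ fun t => by
      rw [Real.norm_of_nonneg (hρ.iterKernel_nonneg n t y)]
      exact hρ.iterKernel_le n t y)

/-- Dropping all weights but the first one increases the iterated kernels, since `kern` is
positive. -/
theorem IsWeight.iterKernel_le_weight_mul (hρ : IsWeight ρ) (n : ℕ) (x y : ℝ) :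
    iterKernel (wKernel ρ) n x y ≤ ρ x * iterKernel (wKernel fun _ => 1) n x y := by
  induction n generalizing x with
  | zero => simp [iterKernel, wKernel]
  | succ n ih =>
    simp only [iterKernel]
    rw [← integral_const_mul]
    refine integral_mono (hρ.integrable_wKernel_mul_iterKernel n x y)
      ((isWeight_one.integrable_wKernel_mul_iterKernel n x y).const_mul _) fun t => ?_
    have h1 := ih t
    have h2 : iterKernel (wKernel ρ) n t y ≤ iterKernel (wKernel fun _ => 1) n t y :=
      h1.trans (mul_le_of_le_one_left (isWeight_one.iterKernel_nonneg n t y) (hρ.le_one t))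
    calc wKernel ρ x t * iterKernel (wKernel ρ) n t y
        ≤ wKernel ρ x t * iterKernel (wKernel fun _ => 1) n t y :=
          mul_le_mul_of_nonneg_left h2 (hρ.wKernel_nonneg x t)
      _ = _ := by simp only [wKernel]; ring

theorem integrable_sech_pi_pow (n : ℕ) :
    Integrable fun k : ℝ => ((Real.cosh (Real.pi * k))⁻¹) ^ (n + 1) := by
  simp_rw [pow_succ']
  refine integrable_sech_pi.mul_bdd (c := 1) ?_ (ae_of_all _ fun k => ?_)
  · exact (((Real.continuous_cosh.comp (by fun_prop)).inv₀
      fun k => (Real.cosh_pos _).ne').pow n).aestronglyMeasurable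
  · have h1 := Real.one_le_cosh (Real.pi * k)
    have h0 := Real.cosh_pos (Real.pi * k)
    rw [Real.norm_of_nonneg (by positivity)]
    exact pow_le_one₀ (by positivity) (inv_le_one_of_one_le₀ h1)

/-- In Fourier space, the iterated kernels of a difference kernel are powers. -/
theorem iterKernel_one_eq_integral (n : ℕ) (x y : ℝ) :
    iterKernel (wKernel fun _ => 1) n x y = (2 * Real.pi)⁻¹ *
      ∫ k, ((Real.cosh (Real.pi * k))⁻¹) ^ (n + 1) * Real.cos (k * (x - y)) := by
  induction n generalizing x with
  | zero => simp only [iterKernel, wKernel_one, zero_add, pow_one]; exact kern_eq_integral _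
  | succ n ih =>
    simp only [iterKernel, ih]
    have hint : Integrable (fun p : ℝ × ℝ => wKernel (fun _ => 1) x p.1 *
        (((Real.cosh (Real.pi * p.2))⁻¹) ^ (n + 1) * Real.cos (p.2 * (p.1 - y))))
        (volume.prod volume) := by
      have h1 := (integrable_wKernel (fun _ => 1) x).mul_prod (integrable_sech_pi_pow n)
      simp_rw [← mul_assoc]
      exact h1.mul_bdd (c := 1) (by fun_prop) (ae_of_all _ fun p => Real.abs_cos_le_one _)
    have h2 : ∀ t, wKernel (fun _ => 1) x t * ((2 * Real.pi)⁻¹ *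
        ∫ k, ((Real.cosh (Real.pi * k))⁻¹) ^ (n + 1) * Real.cos (k * (t - y))) =
        (2 * Real.pi)⁻¹ * ∫ k, wKernel (fun _ => 1) x t *
          (((Real.cosh (Real.pi * k))⁻¹) ^ (n + 1) * Real.cos (k * (t - y))) := by
      intro t
      rw [integral_const_mul]
      ring
    simp_rw [h2]
    rw [integral_const_mul, integral_integral_swap hint]
    congr 2
    funext k
    have h3 : ∀ t, wKernel (fun _ => 1) x t *
        (((Real.cosh (Real.pi * k))⁻¹) ^ (n + 1) * Real.cos (k * (t - y))) =
        ((Real.cosh (Real.pi * k))⁻¹) ^ (n + 1) * (kern (x - t) * Real.cos (k * (t - y))) := by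
      intro t
      rw [wKernel_one]
      ring
    simp_rw [h3]
    rw [integral_const_mul, integral_kern_sub_mul_cos]
    ring

/-- The integrals `∫ sech^(n+1)`. The exponent is shifted, so that all of them converge. -/
noncomputable def sechInt (n : ℕ) : ℝ := ∫ u, ((Real.cosh u)⁻¹) ^ (n + 1)

theorem iterKernel_one_diag (n : ℕ) (x : ℝ) :
    iterKernel (wKernel fun _ => 1) n x x = (2 * Real.pi ^ 2)⁻¹ * sechInt n := by
  rw [iterKernel_one_eq_integral, sechInt]
  simp only [sub_self, mul_zero, Real.cos_zero, mul_one]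
  rw [Measure.integral_comp_mul_left (fun u => ((Real.cosh u)⁻¹) ^ (n + 1)) Real.pi,
    abs_of_pos (by positivity), smul_eq_mul]
  field_simp

theorem measurable_pathSum {ι : Type*} [DecidableEq ι] {A : ℝ → ℝ → ℝ}
    (hA : Measurable fun p : ℝ × ℝ => A p.1 p.2) (n : ℕ) (y : ℝ) (J : Finset ι) :
    Measurable fun p : ℝ × (ι → ℝ) => pathSum A p.2 n p.1 y J := by
  induction n generalizing J with
  | zero => exact hA.comp (by fun_prop : Measurable fun p : ℝ × (ι → ℝ) => (p.1, y))
  | succ n ih =>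
    simp only [pathSum]
    refine Finset.measurable_sum _ fun j _ => ?_
    exact (hA.comp (by fun_prop : Measurable fun p : ℝ × (ι → ℝ) => (p.1, p.2 j))).mul
      ((ih _).comp (by fun_prop : Measurable fun p : ℝ × (ι → ℝ) => (p.2 j, p.2)))

theorem pathSum_succ_univ (A : ℝ → ℝ → ℝ) (n : ℕ) (θ : Fin (n + 1) → ℝ) (x y : ℝ) :
    pathSum A θ (n + 1) x y Finset.univ = ∑ j, A x (θ j) *
      pathSum A (fun k => θ (j.succAbove k)) n (θ j) y Finset.univ := by
  simp only [pathSum]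
  refine Finset.sum_congr rfl fun j _ => ?_
  have : (Finset.univ.erase j : Finset (Fin (n + 1))) = Finset.univ.map (Fin.succAboveEmb j) := by
    ext k
    simp [Fin.exists_succAbove_eq_iff]
  rw [this, pathSum_map]
  rfl

/-- Splitting off one of the variables of an integral over `Fin (n + 1) → ℝ`. -/
theorem integrable_succAbove {n : ℕ} (j : Fin (n + 1)) {F : ℝ × (Fin n → ℝ) → ℝ}
    (hF : Integrable F (volume.prod volume)) :
    Integrable fun θ : Fin (n + 1) → ℝ => F (θ j, fun k => θ (j.succAbove k)) :=
  (volume_preserving_piFinSuccAbove (fun _ : Fin (n + 1) => ℝ) j).integrable_comp_of_integrable hF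

theorem integral_succAbove {n : ℕ} (j : Fin (n + 1)) (F : ℝ × (Fin n → ℝ) → ℝ) :
    ∫ θ : Fin (n + 1) → ℝ, F (θ j, fun k => θ (j.succAbove k)) = ∫ p, F p ∂(volume.prod volume) :=
  (volume_preserving_piFinSuccAbove (fun _ : Fin (n + 1) => ℝ) j).integral_comp'
    (f := MeasurableEquiv.piFinSuccAbove (fun _ => ℝ) j) F

/-- The `n!` orderings of the intermediate points all contribute the same iterated kernel. -/
theorem IsWeight.integral_pathSum (hρ : IsWeight ρ) (n : ℕ) (x y : ℝ) :
    Integrable (fun θ : Fin n → ℝ => pathSum (wKernel ρ) θ n x y Finset.univ) ∧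
    ∫ θ : Fin n → ℝ, pathSum (wKernel ρ) θ n x y Finset.univ =
      n.factorial * iterKernel (wKernel ρ) n x y := by
  induction n generalizing x with
  | zero =>
    simp only [pathSum, iterKernel]
    refine ⟨integrable_const _, ?_⟩
    rw [volume_pi, Measure.pi_of_empty, integral_dirac, Nat.factorial_zero, Nat.cast_one, one_mul]
  | succ n ih =>
    set F : ℝ × (Fin n → ℝ) → ℝ := fun p =>
      wKernel ρ x p.1 * pathSum (wKernel ρ) p.2 n p.1 y Finset.univ with hF
    have hpos : ∀ (m : ℕ) (θ : Fin n → ℝ) (t : ℝ) (J : Finset (Fin n)),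
        0 ≤ pathSum (wKernel ρ) θ m t y J := by
      intro m
      induction m with
      | zero => exact fun θ t J => hρ.wKernel_nonneg t y
      | succ m ihm =>
        exact fun θ t J => Finset.sum_nonneg fun j _ =>
          mul_nonneg (hρ.wKernel_nonneg _ _) (ihm θ _ _)
    have hmeas : Measurable F :=
      (hρ.measurable_wKernel.comp
        (by fun_prop : Measurable fun p : ℝ × (Fin n → ℝ) => (x, p.1))).mul
        (measurable_pathSum hρ.measurable_wKernel n y Finset.univ)
    have hinner : ∀ t, ∫ θ, F (t, θ) =
        n.factorial * (wKernel ρ x t * iterKernel (wKernel ρ) n t y) := by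
      intro t
      simp only [hF]
      rw [integral_const_mul, (ih t).2]
      ring
    have hint : Integrable F (volume.prod volume) := by
      rw [integrable_prod_iff hmeas.aestronglyMeasurable]
      refine ⟨ae_of_all _ fun t => (ih t).1.const_mul (wKernel ρ x t), ?_⟩
      have : ∀ t θ, ‖F (t, θ)‖ = F (t, θ) := fun t θ =>
        Real.norm_of_nonneg (mul_nonneg (hρ.wKernel_nonneg _ _) (hpos _ _ _ _))
      simp_rw [this, hinner]
      exact (hρ.integrable_wKernel_mul_iterKernel n x y).const_mul _
    have hI : ∫ p, F p ∂(volume.prod volume) =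
        n.factorial * iterKernel (wKernel ρ) (n + 1) x y := by
      rw [integral_prod _ hint]
      simp_rw [hinner]
      rw [integral_const_mul, iterKernel]
    simp_rw [pathSum_succ_univ]
    refine ⟨integrable_finsetSum _ fun j _ => integrable_succAbove j hint, ?_⟩
    rw [integral_finsetSum _ fun j _ => integrable_succAbove j hint]
    rw [Finset.sum_congr rfl fun j _ => (integral_succAbove j F).trans hI, Finset.sum_const,
      Finset.card_univ, Fintype.card_fin, nsmul_eq_mul, Nat.factorial_succ]
    push_cast
    ring

theorem integrable_h_snoc (n : ℕ) :
    Integrable fun θ : Fin n → ℝ => h (n + 1) (Fin.snoc (α := fun _ => ℝ) θ 0) := by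
  simp_rw [h_snoc, ← wKernel_one]
  exact (isWeight_one.integral_pathSum n 0 0).1.const_mul _

theorem integral_h_snoc (n : ℕ) :
    ∫ θ : Fin n → ℝ, h (n + 1) (Fin.snoc (α := fun _ => ℝ) θ 0) =
      (-1) ^ n * (n.factorial * ((2 * Real.pi ^ 2)⁻¹ * sechInt n)) := by
  simp_rw [h_snoc, ← wKernel_one]
  rw [integral_const_mul, (isWeight_one.integral_pathSum n 0 0).2, iterKernel_one_diag]

end IteratedKernels

/-! ### Integrals of powers of `sech` and their sums -/

section Sums

theorem integrable_sech_pow (n : ℕ) : Integrable fun u : ℝ => ((Real.cosh u)⁻¹) ^ (n + 1) := by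
  have h := (integrable_sech_pi_pow n).comp_mul_left' (R := Real.pi⁻¹) (by positivity)
  simpa only [← mul_assoc, mul_inv_cancel₀ Real.pi_ne_zero, one_mul] using h

theorem hasDerivAt_sinh_mul_sech_pow (n : ℕ) (u : ℝ) :
    HasDerivAt (fun u => Real.sinh u * ((Real.cosh u)⁻¹) ^ (n + 1))
      ((n + 1) * ((Real.cosh u)⁻¹) ^ (n + 2) - n * ((Real.cosh u)⁻¹) ^ n) u := by
  have hc := (Real.cosh_pos u).ne'
  have h1 := (Real.hasDerivAt_sinh u).mul (((Real.hasDerivAt_cosh u).inv hc).pow (n + 1))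
  refine h1.congr_deriv ?_
  have h2 : Real.cosh u * (Real.cosh u)⁻¹ = 1 := mul_inv_cancel₀ hc
  have h3 : Real.sinh u ^ 2 = Real.cosh u ^ 2 - 1 := Real.sinh_sq u
  simp only [Pi.pow_apply, Pi.inv_apply, Nat.add_sub_cancel]
  rw [div_eq_mul_inv, ← inv_pow]
  push_cast
  linear_combination ((Real.cosh u)⁻¹ ^ n - (n + 1) * (Real.cosh u)⁻¹ ^ n *
    (Real.cosh u * (Real.cosh u)⁻¹ + 1)) * h2 - (n + 1) * (Real.cosh u)⁻¹ ^ (n + 2) * h3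

theorem sech_nonneg (u : ℝ) : 0 ≤ (Real.cosh u)⁻¹ := (inv_pos.2 (Real.cosh_pos u)).le

theorem sech_le_one (u : ℝ) : (Real.cosh u)⁻¹ ≤ 1 := inv_le_one_of_one_le₀ (Real.one_le_cosh u)

theorem tendsto_sech_atTop : Tendsto (fun u => (Real.cosh u)⁻¹) atTop (𝓝 0) :=
  (tendsto_atTop_mono (fun u => by
    rw [Real.cosh_eq]
    linarith [Real.exp_pos (-u)]) (Real.tendsto_exp_atTop.atTop_div_const
      (zero_lt_two' ℝ))).inv_tendsto_atTop

theorem tendsto_sech_atBot : Tendsto (fun u => (Real.cosh u)⁻¹) atBot (𝓝 0) := by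
  simpa only [Function.comp_def, Real.cosh_neg] using
    tendsto_sech_atTop.comp tendsto_neg_atBot_atTop

/-- The case `n = 0` of `iterKernel_one_diag`. -/
theorem sechInt_zero : sechInt 0 = Real.pi := by
  have h1 := iterKernel_one_diag 0 0
  simp only [iterKernel, wKernel_one, sub_self, kern, zero_div, Real.cosh_zero] at h1
  field_simp at h1
  linarith

theorem abs_sinh_mul_sech_le (u : ℝ) : |Real.sinh u * (Real.cosh u)⁻¹| ≤ 1 := by
  rw [← div_eq_mul_inv, ← Real.tanh_eq_sinh_div_cosh]
  exact (Real.abs_tanh_lt_one u).le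

/-- Integration of the derivative of `sinh * sech^(n+2)`. -/
theorem sechInt_add_two (n : ℕ) : (n + 2) * sechInt (n + 2) = (n + 1) * sechInt n := by
  have hlim : ∀ l : Filter ℝ, Tendsto (fun u => (Real.cosh u)⁻¹) l (𝓝 0) →
      Tendsto (fun u => Real.sinh u * ((Real.cosh u)⁻¹) ^ (n + 1 + 1)) l (𝓝 0) := by
    intro l hl
    have h1 : ∀ u : ℝ, Real.sinh u * ((Real.cosh u)⁻¹) ^ (n + 1 + 1) =
        Real.sinh u * (Real.cosh u)⁻¹ * ((Real.cosh u)⁻¹) ^ (n + 1) := fun u => by ring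
    simp_rw [h1]
    refine bdd_le_mul_tendsto_zero' 1 (Eventually.of_forall fun u => abs_sinh_mul_sech_le u) ?_
    simpa using hl.pow (n + 1)
  have h := integral_of_hasDerivAt_of_tendsto (hasDerivAt_sinh_mul_sech_pow (n + 1))
    (((integrable_sech_pow (n + 2)).const_mul _).sub
      ((integrable_sech_pow n).const_mul _))
    (hlim _ tendsto_sech_atBot) (hlim _ tendsto_sech_atTop)
  rw [integral_sub ((integrable_sech_pow (n + 2)).const_mul _)
      ((integrable_sech_pow n).const_mul _), integral_const_mul, integral_const_mul] at h
  push_cast at h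
  unfold sechInt
  linarith

theorem sechInt_one : sechInt 1 = 2 := by
  have h1 : ∀ u : ℝ, Real.sinh u * ((Real.cosh u)⁻¹) ^ (0 + 1) =
      1 - Real.exp (-u) * (Real.cosh u)⁻¹ := by
    intro u
    have hc := (Real.cosh_pos u).ne'
    rw [← Real.cosh_sub_sinh, zero_add, pow_one, sub_mul, mul_inv_cancel₀ hc, sub_sub_cancel]
  have h2 : ∀ u : ℝ, Real.sinh u * ((Real.cosh u)⁻¹) ^ (0 + 1) =
      Real.exp u * (Real.cosh u)⁻¹ - 1 := by
    intro u
    have hc := (Real.cosh_pos u).ne'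
    rw [← Real.cosh_add_sinh, zero_add, pow_one, add_mul, mul_inv_cancel₀ hc, add_sub_cancel_left]
  have ht : Tendsto (fun u => Real.sinh u * ((Real.cosh u)⁻¹) ^ (0 + 1)) atTop (𝓝 1) := by
    simp_rw [h1]
    simpa using (Real.tendsto_exp_neg_atTop_nhds_zero.mul tendsto_sech_atTop).const_sub 1
  have hb : Tendsto (fun u => Real.sinh u * ((Real.cosh u)⁻¹) ^ (0 + 1)) atBot (𝓝 (-1)) := by
    simp_rw [h2]
    simpa using (Real.tendsto_exp_atBot.mul tendsto_sech_atBot).sub_const 1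
  have h := integral_of_hasDerivAt_of_tendsto (hasDerivAt_sinh_mul_sech_pow 0)
    (by simpa using integrable_sech_pow 1) hb ht
  rw [sechInt]
  norm_num at h ⊢
  exact h

theorem sechInt_nonneg (n : ℕ) : 0 ≤ sechInt n :=
  integral_nonneg fun u => pow_nonneg (sech_nonneg u) _

theorem tendsto_sechInt : Tendsto sechInt atTop (𝓝 0) := by
  have h := tendsto_integral_of_dominated_convergence (μ := (volume : Measure ℝ))
    (F := fun (n : ℕ) u => ((Real.cosh u)⁻¹) ^ (n + 1)) (f := fun _ => 0)
    (fun u => ((Real.cosh u)⁻¹) ^ (0 + 1))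
    (fun n => (integrable_sech_pow n).aestronglyMeasurable) (integrable_sech_pow 0)
    (fun n => ae_of_all _ fun u => by
      rw [Real.norm_of_nonneg (pow_nonneg (sech_nonneg u) _)]
      exact pow_le_pow_of_le_one (sech_nonneg u) (sech_le_one u) (by omega)) ?_
  · rwa [integral_zero] at h
  · have h0 : ∀ᵐ u : ℝ, u ≠ 0 := by simp [ae_iff]
    filter_upwards [h0] with u hu
    exact (tendsto_pow_atTop_nhds_zero_of_lt_one (sech_nonneg u)
      (inv_lt_one_of_one_lt₀ (Real.one_lt_cosh.2 hu))).comp (tendsto_add_atTop_nat 1)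

/-- The integrals `∫ x cos^m x` over `[0, π / 2]`, whose two-term recursion makes the sums over
`sechInt n / (n + 1)` telescope. -/
noncomputable def cosMoment (m : ℕ) : ℝ := ∫ x in (0 : ℝ)..(Real.pi / 2), x * Real.cos x ^ m

theorem cosMoment_zero : cosMoment 0 = Real.pi ^ 2 / 8 := by
  simp [cosMoment]
  ring

theorem cosMoment_one : cosMoment 1 = Real.pi / 2 - 1 := by
  have h : ∀ x ∈ Set.uIcc 0 (Real.pi / 2),
      HasDerivAt (fun x => x * Real.sin x + Real.cos x) (x * Real.cos x ^ 1) x := by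
    intro x _
    refine (((hasDerivAt_id x).mul (Real.hasDerivAt_sin x)).add
      (Real.hasDerivAt_cos x)).congr_deriv ?_
    simp
  rw [cosMoment, intervalIntegral.integral_eq_sub_of_hasDerivAt h
    (by apply Continuous.intervalIntegrable; fun_prop)]
  simp

theorem cosMoment_add_two (m : ℕ) :
    (m + 2) * (m + 1) * cosMoment m - (m + 2) ^ 2 * cosMoment (m + 2) = 1 := by
  have h : ∀ x ∈ Set.uIcc 0 (Real.pi / 2),
      HasDerivAt (fun x => -((m + 2) * (x * (Real.sin x * Real.cos x ^ (m + 1)))) -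
          Real.cos x ^ (m + 2))
        ((m + 2) * (m + 1) * (x * Real.cos x ^ m) -
          (m + 2) ^ 2 * (x * Real.cos x ^ (m + 2))) x := by
    intro x _
    have hs := Real.hasDerivAt_sin x
    have hc := Real.hasDerivAt_cos x
    refine (((((hasDerivAt_id x).mul (hs.mul (hc.pow (m + 1)))).const_mul ((m : ℝ) + 2)).neg).sub
      (hc.pow (m + 2))).congr_deriv ?_
    have h2 : Real.sin x ^ 2 = 1 - Real.cos x ^ 2 := Real.sin_sq x
    have e1 : m + 1 - 1 = m := rfl
    have e2 : m + 2 - 1 = m + 1 := rfl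
    simp only [id, Pi.pow_apply, Pi.mul_apply, e1, e2]
    push_cast
    linear_combination ((m : ℝ) + 2) * (m + 1) * x * Real.cos x ^ m * h2
  have h1 := intervalIntegral.integral_eq_sub_of_hasDerivAt h
    (by apply Continuous.intervalIntegrable; fun_prop)
  rw [intervalIntegral.integral_sub (by apply Continuous.intervalIntegrable; fun_prop)
    (by apply Continuous.intervalIntegrable; fun_prop), intervalIntegral.integral_const_mul,
    intervalIntegral.integral_const_mul] at h1
  rw [cosMoment, cosMoment, h1]
  simp

theorem cosMoment_nonneg (m : ℕ) : 0 ≤ cosMoment m :=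
  intervalIntegral.integral_nonneg (by positivity) fun x hx =>
    mul_nonneg hx.1 (pow_nonneg (Real.cos_nonneg_of_neg_pi_div_two_le_of_le
      (by linarith [hx.1, Real.pi_pos]) hx.2) _)

/-- The factor `x` is replaced by `π / 2 * sin x` (Jordan's inequality), which makes the integrand a
derivative. -/
theorem cosMoment_le (m : ℕ) : (m + 1) * cosMoment m ≤ Real.pi / 2 := by
  have hd : ∀ x ∈ Set.uIcc 0 (Real.pi / 2),
      HasDerivAt (fun x => -(Real.pi / 2 * Real.cos x ^ (m + 1)))
        ((m + 1) * (Real.pi / 2 * Real.sin x * Real.cos x ^ m)) x := by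
    intro x _
    refine ((((Real.hasDerivAt_cos x).pow (m + 1)).const_mul (Real.pi / 2)).neg).congr_deriv ?_
    have e1 : m + 1 - 1 = m := rfl
    rw [e1]
    push_cast
    ring
  have h1 := intervalIntegral.integral_eq_sub_of_hasDerivAt hd
    (by apply Continuous.intervalIntegrable; fun_prop)
  have h2 : (m + 1) * cosMoment m ≤
      ∫ x in (0 : ℝ)..(Real.pi / 2), (m + 1) * (Real.pi / 2 * Real.sin x * Real.cos x ^ m) := by
    rw [cosMoment, ← intervalIntegral.integral_const_mul]
    refine intervalIntegral.integral_mono_on (by positivity)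
      (by apply Continuous.intervalIntegrable; fun_prop)
      (by apply Continuous.intervalIntegrable; fun_prop) fun x hx => ?_
    have hc : 0 ≤ Real.cos x := Real.cos_nonneg_of_neg_pi_div_two_le_of_le
      (by linarith [hx.1, Real.pi_pos]) hx.2
    -- Jordan's inequality `2 / π * x ≤ sin x`
    have hs : x ≤ Real.pi / 2 * Real.sin x := by
      have := Real.mul_le_sin hx.1 hx.2
      have hpi := Real.pi_pos
      calc x = Real.pi / 2 * (2 / Real.pi * x) := by field_simp
        _ ≤ _ := by gcongr
    gcongr
  refine h2.trans (h1.le.trans ?_)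
  simp

/-- The sum over one parity telescopes: with `Q n = (n + 1) * sechInt n * cosMoment (n + 1)`, the
two recursions give `sechInt (n + 2) / (n + 3) = Q n - Q (n + 2)`, and `Q` tends to `0`. -/
theorem hasSum_sechInt (j : ℕ) :
    HasSum (fun k : ℕ => sechInt (2 * k + j + 2) / ((2 * k + j + 2 : ℕ) + 1))
      ((j + 1) * sechInt j * cosMoment (j + 1)) := by
  rw [hasSum_iff_tendsto_nat_of_nonneg fun k => div_nonneg (sechInt_nonneg _) (by positivity)]
  set Q : ℕ → ℝ := fun n => (n + 1) * sechInt n * cosMoment (n + 1) with hQ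
  have hstep : ∀ n, sechInt (n + 2) / ((n + 2 : ℕ) + 1) = Q n - Q (n + 2) := by
    intro n
    have h1 := sechInt_add_two n
    have h2 := cosMoment_add_two (n + 1)
    simp only [hQ]
    push_cast at h2 ⊢
    rw [div_eq_iff (by positivity), ← h1]
    linear_combination (-sechInt (n + 2)) * h2
  have hsum : ∀ N, ∑ k ∈ Finset.range N, sechInt (2 * k + j + 2) / ((2 * k + j + 2 : ℕ) + 1) =
      Q j - Q (2 * N + j) := by
    intro N
    rw [Finset.sum_congr rfl fun k _ => hstep (2 * k + j)]
    have := Finset.sum_range_sub' (fun k => Q (2 * k + j)) N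
    simp only [mul_zero, zero_add] at this
    rw [← this]
    refine Finset.sum_congr rfl fun k _ => ?_
    rw [show 2 * (k + 1) + j = 2 * k + j + 2 by ring]
  have hQ0 : Tendsto Q atTop (𝓝 0) := by
    refine squeeze_zero (fun n => ?_) (fun n => ?_)
      (by simpa using tendsto_sechInt.mul_const (Real.pi / 2))
    · exact mul_nonneg (mul_nonneg (by positivity) (sechInt_nonneg n)) (cosMoment_nonneg _)
    · have h1 := cosMoment_le (n + 1)
      have h2 := cosMoment_nonneg (n + 1)
      push_cast at h1
      calc Q n = sechInt n * ((n + 1) * cosMoment (n + 1)) := by simp only [hQ]; ring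
        _ ≤ sechInt n * (Real.pi / 2) :=
          mul_le_mul_of_nonneg_left (by linarith) (sechInt_nonneg n)
  simp_rw [hsum]
  have h3 : Tendsto (fun N : ℕ => 2 * N + j) atTop atTop :=
    tendsto_atTop_mono (fun N => (by omega : N ≤ 2 * N + j)) tendsto_id
  simpa using (hQ0.comp h3).const_sub (Q j)

theorem hasSum_sechInt_even :
    HasSum (fun k : ℕ => sechInt (2 * k) / ((2 * k : ℕ) + 1)) (Real.pi ^ 2 / 2) := by
  have h := hasSum_sechInt 0
  rw [zero_add, cosMoment_one, sechInt_zero] at h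
  simp only [add_zero] at h
  have h1 := (hasSum_nat_add_iff (f := fun k : ℕ => sechInt (2 * k) / ((2 * k : ℕ) + 1)) 1).1 h
  rw [Finset.sum_range_one, mul_zero, sechInt_zero] at h1
  have h2 : Real.pi * (Real.pi / 2 - 1) + Real.pi = Real.pi ^ 2 / 2 := by ring
  simpa only [Nat.cast_zero, zero_add, one_mul, div_one, h2] using h1

theorem hasSum_sechInt_odd :
    HasSum (fun k : ℕ => sechInt (2 * k + 1) / ((2 * k + 1 : ℕ) + 1)) (Real.pi ^ 2 / 4) := by
  have h := hasSum_sechInt 1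
  have h1 := (hasSum_nat_add_iff
    (f := fun k : ℕ => sechInt (2 * k + 1) / ((2 * k + 1 : ℕ) + 1)) 1).1 h
  have h2 := cosMoment_add_two 0
  rw [cosMoment_zero] at h2
  rw [Finset.sum_range_one, mul_zero, zero_add, sechInt_one] at h1
  convert! h1 using 1
  push_cast at h2 ⊢
  linarith

theorem summable_sechInt : Summable fun n : ℕ => sechInt n / ((n : ℝ) + 1) :=
  (HasSum.even_add_odd (f := fun n : ℕ => sechInt n / ((n : ℝ) + 1))
    hasSum_sechInt_even hasSum_sechInt_odd).summable

theorem sechInt_two_mul (k : ℕ) :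
    sechInt (2 * k) = Real.pi * (2 * k).factorial / (k.factorial ^ 2 * 4 ^ k) := by
  induction k with
  | zero => simp [sechInt_zero]
  | succ k ih =>
    have h := sechInt_add_two (2 * k)
    rw [ih] at h
    rw [show 2 * (k + 1) = 2 * k + 2 by ring, Nat.factorial_succ, Nat.factorial_succ,
      Nat.factorial_succ k, pow_succ]
    push_cast at h ⊢
    field_simp at h ⊢
    linear_combination (2 * k + 2 : ℝ) * h

theorem sechInt_two_mul_add_one (k : ℕ) : sechInt (2 * k + 1) =
    (k + 1) * k.factorial ^ 2 * 4 ^ (k + 1) / (2 * k + 2).factorial := by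
  induction k with
  | zero => norm_num [sechInt_one]
  | succ k ih =>
    have h := sechInt_add_two (2 * k + 1)
    rw [ih] at h
    rw [show 2 * (k + 1) + 1 = 2 * k + 1 + 2 by ring, show 2 * (k + 1) + 2 = 2 * k + 2 + 2 by ring,
      Nat.factorial_succ (2 * k + 2 + 1), Nat.factorial_succ (2 * k + 2),
      Nat.factorial_succ k, pow_succ 4 (k + 1)]
    push_cast at h ⊢
    field_simp at h ⊢
    linear_combination (2 * k + 4 : ℝ) * h

theorem rapidityIntegral_succ (n : ℕ) : rapidityIntegral (n + 1) =
    (2 * Real.pi) ^ (n + 1) * ((-1) ^ n * (n.factorial * ((2 * Real.pi ^ 2)⁻¹ * sechInt n))) := by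
  rw [rapidityIntegral, integral_h_snoc]

theorem half_factorial_inv_mul (n : ℕ) (J : ℝ) :
    1 / 2 * (((n + 1).factorial : ℝ)⁻¹ * ((-1) ^ n * (n.factorial * ((2 * Real.pi ^ 2)⁻¹ * J)))) =
      (-1) ^ n * ((4 * Real.pi ^ 2)⁻¹ * (J / (n + 1))) := by
  rw [Nat.factorial_succ]
  push_cast
  field_simp
  ring

/-- The contribution of the `n + 1`-particle states to the dimension. -/
theorem contribution_eq (n : ℕ) : 1 / 2 * (((n + 1).factorial : ℝ)⁻¹ *
    (1 / (2 * Real.pi)) ^ (n + 1) * rapidityIntegral (n + 1)) =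
      (-1) ^ n * ((4 * Real.pi ^ 2)⁻¹ * (sechInt n / (n + 1))) := by
  rw [rapidityIntegral_succ, ← half_factorial_inv_mul, one_div_pow, one_div (_ ^ _),
    mul_assoc _ (_⁻¹), inv_mul_cancel_left₀ (by positivity)]

theorem hasSum_contribution_odd : HasSum (fun k : ℕ =>
    (-1 : ℝ) ^ (2 * k) * ((4 * Real.pi ^ 2)⁻¹ * (sechInt (2 * k) / ((2 * k : ℕ) + 1))))
      (1 / 8) := by
  convert! hasSum_sechInt_even.mul_left (4 * Real.pi ^ 2)⁻¹ using 1
  · funext k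
    rw [pow_mul]
    simp
  · field_simp
    norm_num

theorem hasSum_contribution_even : HasSum (fun k : ℕ =>
    (-1 : ℝ) ^ (2 * k + 1) * ((4 * Real.pi ^ 2)⁻¹ * (sechInt (2 * k + 1) / ((2 * k + 1 : ℕ) + 1))))
      (-(1 / 16)) := by
  convert! hasSum_sechInt_odd.mul_left (-(4 * Real.pi ^ 2)⁻¹) using 1
  · funext k
    rw [pow_succ, pow_mul]
    simp
  · field_simp
    norm_num

theorem hasSum_contribution : HasSum (fun n : ℕ =>
    (-1 : ℝ) ^ n * ((4 * Real.pi ^ 2)⁻¹ * (sechInt n / (n + 1)))) (1 / 16) := by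
  convert! hasSum_contribution_odd.even_add_odd
    (f := fun n : ℕ => (-1 : ℝ) ^ n * ((4 * Real.pi ^ 2)⁻¹ * (sechInt n / (n + 1))))
    hasSum_contribution_even using 1
  norm_num

theorem dimension_eq : dimension = 1 / 16 := by
  rw [dimension, ← tsum_mul_left, ← hasSum_contribution.tsum_eq]
  simp_rw [integral_h_snoc, half_factorial_inv_mul]

theorem rapidityIntegral_one : rapidityIntegral 1 = 1 := by
  rw [rapidityIntegral_succ 0, sechInt_zero]
  simp
  field_simp

theorem rapidityIntegral_two : rapidityIntegral 2 = -4 := by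
  rw [rapidityIntegral_succ 1, sechInt_one]
  simp
  field_simp
  norm_num

theorem rapidityIntegral_add_three (n : ℕ) : rapidityIntegral (n + 3) =
    4 * Real.pi ^ 2 * (n + 1) ^ 2 * rapidityIntegral (n + 1) := by
  have h := sechInt_add_two n
  rw [rapidityIntegral_succ (n + 2), rapidityIntegral_succ n, Nat.factorial_succ,
    Nat.factorial_succ]
  push_cast
  rw [pow_succ _ (n + 2), pow_succ _ (n + 1), pow_add (-1 : ℝ) n 2]
  linear_combination (2 * Real.pi) ^ (n + 1) * (4 * Real.pi ^ 2) * (-1) ^ n * (n + 1) *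
    n.factorial * (2 * Real.pi ^ 2)⁻¹ * h

theorem rapidityIntegral_three : rapidityIntegral 3 = 4 * Real.pi ^ 2 := by
  have h := rapidityIntegral_add_three 0
  rw [rapidityIntegral_one] at h
  simpa using h

theorem odd_contribution_eq_Gamma (k : ℕ) :
    1 / 2 * (((2 * k + 1).factorial : ℝ)⁻¹ * (1 / (2 * Real.pi)) ^ (2 * k + 1) *
        rapidityIntegral (2 * k + 1)) =
      1 / (4 * Real.pi) * (Real.Gamma (2 * k + 1) ^ 2 /
        (Real.Gamma (k + 1) ^ 2 * Real.Gamma (2 * k + 2)) * ((4 : ℝ) ^ k)⁻¹) := by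
  have h1 : Real.Gamma (2 * k + 1) = (2 * k).factorial := by
    rw [← Real.Gamma_nat_eq_factorial]; push_cast; rfl
  have h2 : Real.Gamma (2 * k + 2) = (2 * k + 1) * (2 * k).factorial := by
    have : Real.Gamma (2 * k + 2) = (2 * k + 1).factorial := by
      rw [← Real.Gamma_nat_eq_factorial]; push_cast; ring_nf
    rw [this, Nat.factorial_succ]; push_cast; ring
  rw [contribution_eq, h1, h2, Real.Gamma_nat_eq_factorial, sechInt_two_mul, pow_mul]
  push_cast
  field_simp
  norm_num

theorem even_contribution_eq_Gamma (k : ℕ) (hk : 1 ≤ k) :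
    1 / 2 * (((2 * k).factorial : ℝ)⁻¹ * (1 / (2 * Real.pi)) ^ (2 * k) *
        rapidityIntegral (2 * k)) =
      -(1 / (8 * Real.pi ^ 2) * (Real.Gamma k ^ 2 / Real.Gamma (2 * k + 1) * (4 : ℝ) ^ k)) := by
  obtain ⟨j, rfl⟩ := Nat.exists_eq_add_of_le' hk
  have h1 : Real.Gamma (2 * (j + 1 : ℕ) + 1) = (2 * j + 2).factorial := by
    rw [← Real.Gamma_nat_eq_factorial]; push_cast; ring_nf
  have h2 : Real.Gamma (j + 1 : ℕ) = j.factorial := by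
    rw [← Real.Gamma_nat_eq_factorial]; push_cast; rfl
  rw [show 2 * (j + 1) = 2 * j + 1 + 1 by ring, contribution_eq, h1, h2, sechInt_two_mul_add_one,
    pow_succ, pow_mul]
  push_cast
  field_simp
  ring

end Sums

/-! ### The exponential formula -/

section PowerSeries

variable {u : ℕ → ℝ}

theorem summable_abs_mul_pow (hu : Summable fun n : ℕ => |u n| / ((n : ℝ) + 1)) {r : ℝ}
    (hr0 : 0 ≤ r) (hr : r < 1) : Summable fun n : ℕ => |u n| * r ^ n := by
  have h1 : Tendsto (fun n : ℕ => ((n : ℝ) + 1) * r ^ n) atTop (𝓝 0) := by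
    simp_rw [add_mul, one_mul]
    simpa using (tendsto_self_mul_const_pow_of_lt_one hr0 hr).add
      (tendsto_pow_atTop_nhds_zero_of_lt_one hr0 hr)
  obtain ⟨C, hC⟩ := h1.bddAbove_range
  refine Summable.of_nonneg_of_le (fun n => by positivity) (fun n => ?_) (hu.mul_left C)
  have h2 : ((n : ℝ) + 1) * r ^ n ≤ C := hC ⟨n, rfl⟩
  calc |u n| * r ^ n = ((n : ℝ) + 1) * r ^ n * (|u n| / ((n : ℝ) + 1)) := by field_simp
    _ ≤ C * (|u n| / ((n : ℝ) + 1)) := by gcongr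

theorem hasDerivAt_tsum_primitive (hu : Summable fun n : ℕ => |u n| / ((n : ℝ) + 1)) {z : ℝ}
    (hz0 : 0 ≤ z) (hz : z < 1) :
    HasDerivAt (fun z : ℝ => ∑' n : ℕ, u n / ((n : ℝ) + 1) * z ^ (n + 1))
      (∑' n, u n * z ^ n) z := by
  obtain ⟨r, hzr, hr⟩ := exists_between hz
  have hr0 : 0 ≤ r := hz0.trans hzr.le
  refine hasDerivAt_tsum_of_isPreconnected (t := Metric.ball (0 : ℝ) r)
    (g := fun n z => u n / ((n : ℝ) + 1) * z ^ (n + 1)) (g' := fun n z => u n * z ^ n)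
    (summable_abs_mul_pow hu hr0 hr) Metric.isOpen_ball
    (convex_ball (0 : ℝ) r).isPreconnected (fun n y _ => ?_) (fun n y hy => ?_)
    (Metric.mem_ball_self (hz0.trans_lt hzr)) ?_ ?_
  · refine ((hasDerivAt_pow (n + 1) y).const_mul (u n / ((n : ℝ) + 1))).congr_deriv ?_
    rw [Nat.add_sub_cancel]
    push_cast
    field_simp
  · rw [Real.norm_eq_abs, abs_mul, abs_pow]
    have : |y| ≤ r := by simpa using (mem_ball_zero_iff.1 hy).le
    gcongr
  · simp
  · rw [mem_ball_zero_iff, Real.norm_of_nonneg hz0]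
    exact hzr

theorem continuousOn_tsum_primitive (hu : Summable fun n : ℕ => |u n| / ((n : ℝ) + 1)) :
    ContinuousOn (fun z : ℝ => ∑' n : ℕ, u n / ((n : ℝ) + 1) * z ^ (n + 1)) (Set.Icc 0 1) := by
  refine continuousOn_tsum (fun n => by fun_prop) hu fun n z hz => ?_
  rw [norm_mul, norm_pow, Real.norm_of_nonneg hz.1, Real.norm_eq_abs, abs_div,
    abs_of_pos (by positivity : (0 : ℝ) < n + 1)]
  exact mul_le_of_le_one_right (by positivity) (pow_le_one₀ hz.1 hz.2)

/-- The exponential formula: a sequence solving the Newton-type recursion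
`(n + 1) w_{n+1} = ∑_{k ≤ n} t_k w_{n-k}` has the generating function
`exp (∑ t_k z^(k+1) / (k+1))`. The differential equation holds for `z < 1`, and the identity
extends to `z = 1` by continuity. -/
theorem tsum_eq_exp_of_recursion {w t : ℕ → ℝ} (h0 : w 0 = 1) (hw : Summable fun n => |w n|)
    (ht : Summable fun n : ℕ => |t n| / ((n : ℝ) + 1))
    (hrec : ∀ n : ℕ, ((n : ℝ) + 1) * w (n + 1) = ∑ k ∈ Finset.range (n + 1), t k * w (n - k)) :
    ∑' n, w n = Real.exp (∑' k : ℕ, t k / ((k : ℝ) + 1)) := by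
  set v : ℕ → ℝ := fun n => ((n : ℝ) + 1) * w (n + 1) with hv
  have hvw : ∀ n : ℕ, v n / ((n : ℝ) + 1) = w (n + 1) := fun n => by
    simp only [hv]
    field_simp
  have hvs : Summable fun n : ℕ => |v n| / ((n : ℝ) + 1) := by
    refine ((summable_nat_add_iff 1).2 hw).congr fun n => ?_
    rw [← hvw n, abs_div, abs_of_pos (by positivity : (0 : ℝ) < n + 1)]
  set f : ℝ → ℝ := fun z => 1 + ∑' n : ℕ, v n / ((n : ℝ) + 1) * z ^ (n + 1) with hf
  set q : ℝ → ℝ := fun z => ∑' n : ℕ, t n / ((n : ℝ) + 1) * z ^ (n + 1) with hq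
  have hfw : ∀ z ∈ Set.Icc (0 : ℝ) 1, f z = ∑' n, w n * z ^ n := by
    intro z hz
    have hs : Summable fun n => w n * z ^ n := by
      refine Summable.of_norm_bounded hw fun n => ?_
      rw [norm_mul, norm_pow, Real.norm_of_nonneg hz.1, Real.norm_eq_abs]
      exact mul_le_of_le_one_right (abs_nonneg _) (pow_le_one₀ hz.1 hz.2)
    rw [hs.tsum_eq_zero_add, h0, pow_zero, mul_one]
    simp only [hf, hvw]
  have hderiv : ∀ z ∈ Set.Ico (0 : ℝ) 1,
      HasDerivWithinAt (fun z => f z * Real.exp (-q z)) 0 (Set.Ici z) z := by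
    intro z hz
    have hf' : HasDerivAt f (∑' n, v n * z ^ n) z :=
      (hasDerivAt_tsum_primitive hvs hz.1 hz.2).const_add 1
    have hq' : HasDerivAt q (∑' n, t n * z ^ n) z := hasDerivAt_tsum_primitive ht hz.1 hz.2
    refine ((hf'.mul (hq'.neg.exp)).congr_deriv ?_).hasDerivWithinAt
    have hprod : ∑' n, v n * z ^ n = (∑' n, t n * z ^ n) * f z := by
      rw [hfw z ⟨hz.1, hz.2.le⟩, tsum_mul_tsum_eq_tsum_sum_range_of_summable_norm]
      · refine tsum_congr fun n => ?_
        simp only [hv]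
        rw [hrec, Finset.sum_mul]
        refine Finset.sum_congr rfl fun k hk => ?_
        have hk' : k ≤ n := Nat.lt_succ_iff.1 (Finset.mem_range.1 hk)
        calc t k * w (n - k) * z ^ n = t k * w (n - k) * (z ^ k * z ^ (n - k)) := by
              rw [← pow_add, Nat.add_sub_cancel' hk']
          _ = _ := by ring
      · refine (summable_abs_mul_pow ht hz.1 hz.2).congr fun n => ?_
        rw [norm_mul, norm_pow, Real.norm_of_nonneg hz.1, Real.norm_eq_abs]
      · refine Summable.of_nonneg_of_le (fun n => norm_nonneg _) (fun n => ?_) hw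
        rw [norm_mul, norm_pow, Real.norm_of_nonneg hz.1, Real.norm_eq_abs]
        exact mul_le_of_le_one_right (abs_nonneg _) (pow_le_one₀ hz.1 hz.2.le)
    rw [hprod]
    simp only [Pi.neg_apply]
    ring
  have hcont : ContinuousOn (fun z => f z * Real.exp (-q z)) (Set.Icc 0 1) :=
    (continuousOn_const.add (continuousOn_tsum_primitive hvs)).mul
      (Real.continuous_exp.comp_continuousOn (continuousOn_tsum_primitive ht).neg)
  have h1 := constant_of_has_deriv_right_zero hcont hderiv 1 ⟨zero_le_one, le_rfl⟩
  have hf0 : f 0 = 1 := by simp [hf]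
  have hq0 : q 0 = 0 := by simp [hq]
  have hf1 : f 1 = ∑' n, w n := by simpa using hfw 1 ⟨zero_le_one, le_rfl⟩
  have hq1 : q 1 = ∑' k : ℕ, t k / ((k : ℝ) + 1) := by simp [hq]
  simp only [hf0, hq0, hf1, hq1, neg_zero, Real.exp_zero, mul_one] at h1
  rw [Real.exp_neg, ← div_eq_mul_inv, div_eq_one_iff_eq (Real.exp_pos _).ne'] at h1
  exact h1

end PowerSeries

/-! ### Fredholm determinants -/

section Fredholm

variable {ρ : ℝ → ℝ}

theorem kernelDet_wKernel (ρ : ℝ → ℝ) {n : ℕ} (θ : Fin n → ℝ) :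
    kernelDet (wKernel ρ) θ = (∏ i, ρ (θ i)) * kernelDet (fun x y => kern (x - y)) θ :=
  Matrix.det_mul_column (fun i => ρ (θ i)) (Matrix.of fun i j => kern (θ i - θ j))

theorem borderedDet_wKernel (ρ : ℝ → ℝ) {n : ℕ} (θ : Fin n → ℝ) (x y : ℝ) :
    borderedDet (wKernel ρ) θ x y =
      (ρ x * ∏ i, ρ (θ i)) * borderedDet (fun x y => kern (x - y)) θ x y := by
  have h := Matrix.det_mul_column (fun a : Option (Fin n) => ρ (a.elim x θ))
    (Matrix.of fun a b : Option (Fin n) => kern (a.elim x θ - b.elim y θ))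
  rw [Fintype.prod_option] at h
  exact h

theorem continuous_borderedDet_kern (n : ℕ) :
    Continuous fun q : (ℝ × ℝ) × (Fin n → ℝ) =>
      borderedDet (fun x y => kern (x - y)) q.2 q.1.1 q.1.2 := by
  refine Continuous.matrix_det (continuous_matrix fun a b => continuous_kern.comp ?_)
  rcases a with _ | a <;> rcases b with _ | b <;> simp only [Option.elim] <;> fun_prop

/-- A crude bound, from the Leibniz formula, which suffices for integrability. -/
theorem abs_borderedDet_kern_le {n : ℕ} (θ : Fin n → ℝ) (x y : ℝ) :
    |borderedDet (fun x y => kern (x - y)) θ x y| ≤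
      (n + 1).factorial * ((2 * Real.pi)⁻¹) ^ (n + 1) := by
  have h := Matrix.det_le (abv := AbsoluteValue.abs) (x := (2 * Real.pi)⁻¹)
    (A := Matrix.of fun a b : Option (Fin n) => kern (a.elim x θ - b.elim y θ)) fun i j => by
      change |kern _| ≤ _
      rw [abs_of_pos (kern_pos _)]
      exact kern_le _
  rw [Fintype.card_option, Fintype.card_fin, nsmul_eq_mul] at h
  exact h

theorem integrable_prod_weight (hint : Integrable ρ) (n : ℕ) :
    Integrable fun θ : Fin n → ℝ => ∏ i, ρ (θ i) :=
  Integrable.fintype_prod (f := fun _ => ρ) fun _ => hint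

theorem IsWeight.measurable_borderedDet (hρ : IsWeight ρ) (n : ℕ) :
    Measurable fun q : (ℝ × ℝ) × (Fin n → ℝ) => borderedDet (wKernel ρ) q.2 q.1.1 q.1.2 := by
  simp_rw [borderedDet_wKernel]
  have h1 := hρ.measurable
  exact ((h1.comp (by fun_prop : Measurable fun q : (ℝ × ℝ) × (Fin n → ℝ) => q.1.1)).mul
    (Finset.measurable_prod _ fun i _ =>
      h1.comp (by fun_prop : Measurable fun q : (ℝ × ℝ) × (Fin n → ℝ) => q.2 i))).mul
    (continuous_borderedDet_kern n).measurable

theorem IsWeight.abs_borderedDet_le (hρ : IsWeight ρ) {n : ℕ} (θ : Fin n → ℝ) (x y : ℝ) :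
    |borderedDet (wKernel ρ) θ x y| ≤
      ρ x * (∏ i, ρ (θ i)) * ((n + 1).factorial * ((2 * Real.pi)⁻¹) ^ (n + 1)) := by
  have h0 : 0 ≤ ρ x * ∏ i, ρ (θ i) :=
    mul_nonneg (hρ.nonneg x) (Finset.prod_nonneg fun i _ => hρ.nonneg _)
  rw [borderedDet_wKernel, abs_mul, abs_of_nonneg h0]
  exact mul_le_mul_of_nonneg_left (abs_borderedDet_kern_le θ x y) h0

theorem kernelDet_kern_nonneg {n : ℕ} (θ : Fin n → ℝ) :
    0 ≤ kernelDet (fun x y => kern (x - y)) θ := by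
  rw [kernelDet_kern]
  positivity

theorem kernelDet_kern_le {n : ℕ} (θ : Fin n → ℝ) :
    kernelDet (fun x y => kern (x - y)) θ ≤ ((2 * Real.pi) ^ n)⁻¹ := by
  rw [kernelDet_kern]
  refine mul_le_of_le_one_right (by positivity) (Finset.prod_le_one (fun i _ => by positivity)
    fun i _ => Finset.prod_le_one (fun j _ => by positivity) fun j _ => ?_)
  exact (Real.tanh_sq_lt_one _).le

theorem continuous_kernelDet_kern (n : ℕ) :
    Continuous fun θ : Fin n → ℝ => kernelDet (fun x y => kern (x - y)) θ :=
  Continuous.matrix_det (continuous_matrix fun a b => continuous_kern.comp (by fun_prop))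

theorem integrable_kernelDet (hint : Integrable ρ) (n : ℕ) :
    Integrable fun θ : Fin n → ℝ => kernelDet (wKernel ρ) θ := by
  simp_rw [kernelDet_wKernel]
  refine (integrable_prod_weight hint n).mul_bdd (c := ((2 * Real.pi) ^ n)⁻¹)
    (continuous_kernelDet_kern n).aestronglyMeasurable (ae_of_all _ fun θ => ?_)
  rw [Real.norm_of_nonneg (kernelDet_kern_nonneg θ)]
  exact kernelDet_kern_le θ

/-- The `n`-th term of the Fredholm determinant of `1 + A` on `L²(ℝ)`. -/
noncomputable def fredholmTerm (A : ℝ → ℝ → ℝ) (n : ℕ) : ℝ :=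
  (n.factorial : ℝ)⁻¹ * ∫ θ : Fin n → ℝ, kernelDet A θ

/-- The `n`-th term of Fredholm's first minor, the numerator of the resolvent kernel. -/
noncomputable def fredholmMinor (A : ℝ → ℝ → ℝ) (n : ℕ) (x y : ℝ) : ℝ :=
  (n.factorial : ℝ)⁻¹ * ∫ θ : Fin n → ℝ, borderedDet A θ x y

/-- The trace of the `(k + 1)`-st power of the integral operator with kernel `A`. -/
noncomputable def kernelTrace (A : ℝ → ℝ → ℝ) (k : ℕ) : ℝ := ∫ x, iterKernel A k x x

theorem fredholmTerm_zero (A : ℝ → ℝ → ℝ) : fredholmTerm A 0 = 1 := by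
  rw [fredholmTerm, volume_pi, Measure.pi_of_empty, integral_dirac]
  simp [kernelDet]

theorem fredholmMinor_zero (A : ℝ → ℝ → ℝ) (x y : ℝ) : fredholmMinor A 0 x y = A x y := by
  rw [fredholmMinor, volume_pi, Measure.pi_of_empty, integral_dirac]
  simp only [borderedDet, Matrix.det_unique, Nat.factorial_zero, Nat.cast_one, inv_one, one_mul]
  rfl

theorem IsWeight.integrable_borderedDet_step (hρ : IsWeight ρ) (hint : Integrable ρ) (n : ℕ)
    (x y : ℝ) :
    Integrable (fun p : ℝ × (Fin n → ℝ) => wKernel ρ x p.1 * borderedDet (wKernel ρ) p.2 p.1 y)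
      (volume.prod volume) := by
  set C : ℝ := (n + 1).factorial * ((2 * Real.pi)⁻¹) ^ (n + 1)
  refine ((integrable_wKernel ρ x).mul_prod
    ((integrable_prod_weight hint n).mul_const C)).mono'
    ((hρ.measurable_wKernel.comp
      (by fun_prop : Measurable fun p : ℝ × (Fin n → ℝ) => (x, p.1))).mul
      ((hρ.measurable_borderedDet n).comp
      (by fun_prop : Measurable fun p : ℝ × (Fin n → ℝ) => ((p.1, y), p.2)))).aestronglyMeasurable
    (ae_of_all _ fun p => ?_)
  rw [norm_mul, Real.norm_of_nonneg (hρ.wKernel_nonneg _ _), Real.norm_eq_abs]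
  refine mul_le_mul_of_nonneg_left ((hρ.abs_borderedDet_le _ _ _).trans ?_) (hρ.wKernel_nonneg _ _)
  refine mul_le_mul_of_nonneg_right ?_ (by positivity)
  exact mul_le_of_le_one_left (Finset.prod_nonneg fun i _ => hρ.nonneg _) (hρ.le_one _)

/-- Fredholm's recursion for the first minor. -/
theorem IsWeight.fredholmMinor_succ (hρ : IsWeight ρ) (hint : Integrable ρ) (n : ℕ) (x y : ℝ) :
    fredholmMinor (wKernel ρ) (n + 1) x y = wKernel ρ x y * fredholmTerm (wKernel ρ) (n + 1) -
      ∫ t, wKernel ρ x t * fredholmMinor (wKernel ρ) n t y := by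
  have hstep := hρ.integrable_borderedDet_step hint n x y
  have hexp : ∀ θ : Fin (n + 1) → ℝ, borderedDet (wKernel ρ) θ x y =
      wKernel ρ x y * kernelDet (wKernel ρ) θ - ∑ j, wKernel ρ x (θ j) *
        borderedDet (wKernel ρ) (fun k => θ (j.succAbove k)) (θ j) y := by
    intro θ
    rw [borderedDet_expand (wKernel ρ) θ x y (fun j => (finSuccEquiv' j).symm)
      (fun j => finSuccEquiv'_symm_none j)]
    simp only [finSuccEquiv'_symm_some]
  have hinner : ∀ t, ∫ θ : Fin n → ℝ, wKernel ρ x t * borderedDet (wKernel ρ) θ t y =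
      n.factorial * (wKernel ρ x t * fredholmMinor (wKernel ρ) n t y) := by
    intro t
    rw [integral_const_mul, fredholmMinor]
    field_simp
  have hI : ∀ j : Fin (n + 1), ∫ θ : Fin (n + 1) → ℝ, wKernel ρ x (θ j) *
      borderedDet (wKernel ρ) (fun k => θ (j.succAbove k)) (θ j) y =
      n.factorial * ∫ t, wKernel ρ x t * fredholmMinor (wKernel ρ) n t y := by
    intro j
    rw [integral_succAbove j fun p => wKernel ρ x p.1 * borderedDet (wKernel ρ) p.2 p.1 y,
      integral_prod _ hstep]
    simp_rw [hinner]
    rw [integral_const_mul]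
  rw [fredholmMinor]
  simp_rw [hexp]
  rw [integral_sub ((integrable_kernelDet hint (n + 1)).const_mul _)
    (integrable_finsetSum _ fun j _ => integrable_succAbove j hstep), integral_const_mul,
    integral_finsetSum _ fun j _ => integrable_succAbove j hstep,
    Finset.sum_congr rfl fun j _ => hI j, Finset.sum_const, Finset.card_univ, Fintype.card_fin,
    nsmul_eq_mul, fredholmTerm, Nat.factorial_succ]
  push_cast
  field_simp

/-- The solution of Fredholm's recursion, a Neumann series. -/
theorem IsWeight.fredholmMinor_eq_sum (hρ : IsWeight ρ) (hint : Integrable ρ) (n : ℕ) (x y : ℝ) :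
    fredholmMinor (wKernel ρ) n x y = ∑ k ∈ Finset.range (n + 1),
      (-1) ^ k * iterKernel (wKernel ρ) k x y * fredholmTerm (wKernel ρ) (n - k) := by
  induction n generalizing x with
  | zero =>
    rw [fredholmMinor_zero]
    simp [fredholmTerm_zero, iterKernel]
  | succ n ih =>
    rw [hρ.fredholmMinor_succ hint, Finset.sum_range_succ']
    simp_rw [ih, Finset.mul_sum]
    have h1 : ∀ k t, wKernel ρ x t * ((-1) ^ k * iterKernel (wKernel ρ) k t y *
        fredholmTerm (wKernel ρ) (n - k)) = (wKernel ρ x t * iterKernel (wKernel ρ) k t y) *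
          ((-1) ^ k * fredholmTerm (wKernel ρ) (n - k)) := fun k t => by ring
    simp_rw [h1]
    rw [integral_finsetSum _ fun k _ =>
      (hρ.integrable_wKernel_mul_iterKernel k x y).mul_const _]
    simp_rw [integral_mul_const]
    rw [sub_eq_neg_add, ← Finset.sum_neg_distrib]
    congr 1
    · refine Finset.sum_congr rfl fun k _ => ?_
      rw [Nat.add_sub_add_right, iterKernel]
      ring
    · simp [iterKernel]

theorem IsWeight.iterKernel_diag_le (hρ : IsWeight ρ) (k : ℕ) (x : ℝ) :
    iterKernel (wKernel ρ) k x x ≤ ρ x * ((2 * Real.pi ^ 2)⁻¹ * sechInt k) := by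
  rw [← iterKernel_one_diag k x]
  exact hρ.iterKernel_le_weight_mul k x x

theorem IsWeight.measurable_iterKernel_diag (hρ : IsWeight ρ) (k : ℕ) :
    Measurable fun x => iterKernel (wKernel ρ) k x x :=
  (measurable_iterKernel hρ.measurable_wKernel k).comp
    (by fun_prop : Measurable fun x : ℝ => (x, x))

theorem IsWeight.integrable_iterKernel_diag (hρ : IsWeight ρ) (hint : Integrable ρ) (k : ℕ) :
    Integrable fun x => iterKernel (wKernel ρ) k x x :=
  (hint.mul_const ((2 * Real.pi ^ 2)⁻¹ * sechInt k)).mono'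
    (hρ.measurable_iterKernel_diag k).aestronglyMeasurable
    (ae_of_all _ fun x => by
      rw [Real.norm_of_nonneg (hρ.iterKernel_nonneg k x x)]
      exact hρ.iterKernel_diag_le k x)

/-- Newton's identities: the minor on the diagonal integrates to the next term of the determinant.
-/
theorem IsWeight.fredholmTerm_succ (hρ : IsWeight ρ) (hint : Integrable ρ) (n : ℕ) :
    ((n : ℝ) + 1) * fredholmTerm (wKernel ρ) (n + 1) = ∑ k ∈ Finset.range (n + 1),
      ((-1) ^ k * kernelTrace (wKernel ρ) k) * fredholmTerm (wKernel ρ) (n - k) := by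
  have hdet : ∀ θ : Fin (n + 1) → ℝ, kernelDet (wKernel ρ) θ =
      borderedDet (wKernel ρ) (fun k => θ ((0 : Fin (n + 1)).succAbove k)) (θ 0) (θ 0) := by
    intro θ
    rw [← borderedDet_self_eq (wKernel ρ) θ (finSuccEquiv' 0).symm]
    simp only [finSuccEquiv'_symm_some, finSuccEquiv'_symm_none]
  have hF : Integrable (fun p : ℝ × (Fin n → ℝ) => borderedDet (wKernel ρ) p.2 p.1 p.1)
      (volume.prod volume) := by
    refine ((hint.mul_prod (integrable_prod_weight hint n)).mul_const
      ((n + 1).factorial * ((2 * Real.pi)⁻¹) ^ (n + 1))).mono'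
      ((hρ.measurable_borderedDet n).comp
      (by fun_prop : Measurable fun p : ℝ × (Fin n → ℝ) => ((p.1, p.1), p.2))).aestronglyMeasurable
      (ae_of_all _ fun p => hρ.abs_borderedDet_le _ _ _)
  have h1 : ∫ θ : Fin (n + 1) → ℝ, kernelDet (wKernel ρ) θ =
      n.factorial * ∫ x, fredholmMinor (wKernel ρ) n x x := by
    simp_rw [hdet]
    rw [integral_succAbove 0 fun p => borderedDet (wKernel ρ) p.2 p.1 p.1, integral_prod _ hF,
      ← integral_const_mul]
    refine integral_congr_ae (ae_of_all _ fun x => ?_)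
    simp only [fredholmMinor]
    field_simp
  simp_rw [hρ.fredholmMinor_eq_sum hint] at h1
  have h2 : ∀ k x, (-1) ^ k * iterKernel (wKernel ρ) k x x * fredholmTerm (wKernel ρ) (n - k) =
      iterKernel (wKernel ρ) k x x * ((-1) ^ k * fredholmTerm (wKernel ρ) (n - k)) :=
    fun k x => by ring
  simp_rw [h2] at h1
  rw [integral_finsetSum _ fun k _ => (hρ.integrable_iterKernel_diag hint k).mul_const _] at h1
  simp_rw [integral_mul_const] at h1
  rw [fredholmTerm, h1, Nat.factorial_succ]
  push_cast
  rw [mul_inv, mul_assoc, ← mul_assoc, ← mul_assoc, mul_inv_cancel₀ (by positivity), one_mul,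
    ← mul_assoc, inv_mul_cancel₀ (by positivity), one_mul]
  refine Finset.sum_congr rfl fun k _ => ?_
  rw [kernelTrace]
  ring

theorem IsWeight.fredholmTerm_nonneg (hρ : IsWeight ρ) (n : ℕ) :
    0 ≤ fredholmTerm (wKernel ρ) n := by
  refine mul_nonneg (by positivity) (integral_nonneg fun θ => ?_)
  rw [kernelDet_wKernel]
  exact mul_nonneg (Finset.prod_nonneg fun i _ => hρ.nonneg _) (kernelDet_kern_nonneg θ)

/-- Since all factors `tanh²` are at most `1`, the series is dominated by an exponential series. -/
theorem IsWeight.summable_fredholmTerm (hρ : IsWeight ρ) (hint : Integrable ρ) :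
    Summable (fredholmTerm (wKernel ρ)) := by
  refine Summable.of_nonneg_of_le hρ.fredholmTerm_nonneg (fun n => ?_)
    (Real.summable_pow_div_factorial ((2 * Real.pi)⁻¹ * ∫ x, ρ x))
  have h1 : ∫ θ : Fin n → ℝ, kernelDet (wKernel ρ) θ ≤
      ∫ θ : Fin n → ℝ, (∏ i, ρ (θ i)) * ((2 * Real.pi) ^ n)⁻¹ := by
    refine integral_mono (integrable_kernelDet hint n)
      ((integrable_prod_weight hint n).mul_const _) fun θ => ?_
    simp only [kernelDet_wKernel]
    exact mul_le_mul_of_nonneg_left (kernelDet_kern_le θ)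
      (Finset.prod_nonneg fun i _ => hρ.nonneg _)
  rw [integral_mul_const, integral_fintype_prod_volume_eq_pow, Fintype.card_fin] at h1
  rw [fredholmTerm, div_eq_inv_mul, mul_pow, inv_pow, mul_comm (_ ^ n)⁻¹]
  exact mul_le_mul_of_nonneg_left h1 (by positivity)

theorem IsWeight.kernelTrace_nonneg (hρ : IsWeight ρ) (k : ℕ) : 0 ≤ kernelTrace (wKernel ρ) k :=
  integral_nonneg fun x => hρ.iterKernel_nonneg k x x

theorem IsWeight.kernelTrace_le (hρ : IsWeight ρ) (hint : Integrable ρ) (k : ℕ) :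
    kernelTrace (wKernel ρ) k ≤ (∫ x, ρ x) * ((2 * Real.pi ^ 2)⁻¹ * sechInt k) := by
  rw [← integral_mul_const]
  exact integral_mono (hρ.integrable_iterKernel_diag hint k) (hint.mul_const _)
    (hρ.iterKernel_diag_le k)

/-- `log det (1 + A) = Tr log (1 + A)`. The series of traces converges because they are bounded by
multiples of `∫ sech^(k+1)`; no bound on the norm of the operator enters. -/
theorem IsWeight.log_tsum_fredholmTerm (hρ : IsWeight ρ) (hint : Integrable ρ) :
    Real.log (∑' n, fredholmTerm (wKernel ρ) n) =
      ∑' k : ℕ, (-1) ^ k * kernelTrace (wKernel ρ) k / ((k : ℝ) + 1) := by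
  rw [tsum_eq_exp_of_recursion (fredholmTerm_zero _) (hρ.summable_fredholmTerm hint).abs ?_
    (hρ.fredholmTerm_succ hint), Real.log_exp]
  refine Summable.of_nonneg_of_le (fun k => by positivity) (fun k => ?_)
    (summable_sechInt.mul_left ((∫ x, ρ x) * (2 * Real.pi ^ 2)⁻¹))
  rw [abs_mul, abs_pow, abs_neg, abs_one, one_pow, one_mul,
    abs_of_nonneg (hρ.kernelTrace_nonneg k), ← mul_div_assoc, mul_assoc]
  exact div_le_div_of_nonneg_right (hρ.kernelTrace_le hint k) (by positivity)

end Fredholm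

/-! ### The short-distance limit -/

section ShortDistance

/-- The damping `exp (-a cosh x)` of a particle of rapidity `x` at Euclidean distance `a`, in
units of the inverse mass. -/
noncomputable def boltzmann (a x : ℝ) : ℝ := Real.exp (-(a * Real.cosh x))

theorem isWeight_boltzmann {a : ℝ} (ha : 0 ≤ a) : IsWeight (boltzmann a) where
  measurable := by unfold boltzmann; fun_prop
  nonneg x := (Real.exp_pos _).le
  le_one x := Real.exp_le_one_iff.2 (neg_nonpos.2 (mul_nonneg ha (Real.cosh_pos x).le))

theorem integrable_boltzmann {a : ℝ} (ha : 0 < a) : Integrable (boltzmann a) := by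
  refine ((integrable_sech_pow 0).const_mul a⁻¹).mono'
    (isWeight_boltzmann ha.le).measurable.aestronglyMeasurable (ae_of_all _ fun x => ?_)
  have hc := Real.cosh_pos x
  rw [Real.norm_of_nonneg ((isWeight_boltzmann ha.le).nonneg x), boltzmann, Real.exp_neg, zero_add,
    pow_one, ← mul_inv]
  exact inv_anti₀ (by positivity) (by linarith [Real.add_one_le_exp (a * Real.cosh x)])

theorem twoPointIntegrand_eq (m τ : ℝ) (n : ℕ) (θ : Fin n → ℝ) :
    twoPointIntegrand m τ n θ = kernelDet (wKernel (boltzmann (m * τ))) θ := by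
  rw [twoPointIntegrand, kernelDet_wKernel, g_eq_kernelDet]
  simp only [boltzmann]
  rw [← Real.exp_sum, Finset.sum_neg_distrib, ← Finset.mul_sum, mul_comm τ m]

theorem twoPointTerm_eq (m τ : ℝ) :
    twoPointTerm m τ = fredholmTerm (wKernel (boltzmann (m * τ))) := by
  funext n
  rw [twoPointTerm, fredholmTerm]
  simp_rw [twoPointIntegrand_eq]

theorem exp_abs_le_two_mul_cosh (x : ℝ) : Real.exp |x| ≤ 2 * Real.cosh x := by
  rw [← Real.cosh_abs, Real.cosh_eq]
  linarith [Real.exp_pos (-|x|)]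

theorem cosh_le_exp_abs (x : ℝ) : Real.cosh x ≤ Real.exp |x| := by
  rw [← Real.cosh_abs, Real.cosh_eq]
  have : Real.exp (-|x|) ≤ Real.exp |x| := Real.exp_le_exp.2 (by linarith [abs_nonneg x])
  linarith

theorem half_exp_le (l s : ℝ) (hl : 0 ≤ l) :
    Real.exp (l * (|s| - 1)) / 2 ≤ Real.exp (-l) * Real.cosh (l * s) := by
  have h := exp_abs_le_two_mul_cosh (l * s)
  rw [abs_mul, abs_of_nonneg hl] at h
  rw [show l * (|s| - 1) = -l + l * |s| by ring, Real.exp_add]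
  have := Real.exp_pos (-l)
  nlinarith

/-- In the logarithmic scale `x = l * s` at distance `exp (-l)`, the damping is dominated uniformly
in `l`. -/
theorem boltzmann_le (l s : ℝ) (hl : 1 ≤ l) :
    boltzmann (Real.exp (-l)) (l * s) ≤ Real.exp (1 / 2) * (Real.cosh (s / 2))⁻¹ := by
  have h1 := half_exp_le l s (by linarith)
  have h2 : |s| - 1 ≤ Real.exp (l * (|s| - 1)) := by
    rcases le_or_gt (|s| - 1) 0 with h | h
    · exact h.trans (Real.exp_pos _).le
    · nlinarith [Real.add_one_le_exp (l * (|s| - 1))]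
  have h3 : boltzmann (Real.exp (-l)) (l * s) ≤ Real.exp (1 / 2 + -(|s| / 2)) :=
    Real.exp_le_exp.2 (by linarith)
  refine h3.trans ?_
  rw [Real.exp_add, Real.exp_neg]
  have h4 := cosh_le_exp_abs (s / 2)
  rw [abs_div, abs_two] at h4
  exact mul_le_mul_of_nonneg_left (inv_anti₀ (Real.cosh_pos _) h4) (Real.exp_pos _).le

theorem integrable_boltzmann_bound :
    Integrable fun s : ℝ => Real.exp (1 / 2) * (Real.cosh (s / 2))⁻¹ := by
  have h := (integrable_sech_pow 0).comp_mul_left' (R := (1 / 2 : ℝ)) (by norm_num)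
  simp only [zero_add, pow_one, one_div_mul_eq_div] at h
  exact h.const_mul _

/-- The damping is ineffective at rapidities `|x| < l`. -/
theorem tendsto_boltzmann_one {s : ℝ} (hs : |s| < 1) (u : ℝ) :
    Tendsto (fun l => boltzmann (Real.exp (-l)) (l * s + u)) atTop (𝓝 1) := by
  have h1 : Tendsto (fun l => Real.exp (-l) * Real.cosh (l * s + u)) atTop (𝓝 0) := by
    have h2 : Tendsto (fun l => Real.exp (-(l * (1 - |s|))) * Real.exp |u|) atTop (𝓝 0) := by
      have : Tendsto (fun l : ℝ => l * (1 - |s|)) atTop atTop :=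
        tendsto_id.atTop_mul_const (by linarith)
      simpa using (Real.tendsto_exp_neg_atTop_nhds_zero.comp this).mul_const (Real.exp |u|)
    refine squeeze_zero' (Eventually.of_forall fun l =>
      mul_nonneg (Real.exp_pos _).le (Real.cosh_pos _).le) ?_ h2
    filter_upwards [eventually_ge_atTop 0] with l hl
    have h3 : Real.cosh (l * s + u) ≤ Real.exp (l * |s|) * Real.exp |u| := by
      rw [← Real.exp_add]
      refine (cosh_le_exp_abs _).trans (Real.exp_le_exp.2 ((abs_add_le _ _).trans ?_))
      rw [abs_mul, abs_of_nonneg hl]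
    calc Real.exp (-l) * Real.cosh (l * s + u)
        ≤ Real.exp (-l) * (Real.exp (l * |s|) * Real.exp |u|) := by gcongr
      _ = _ := by rw [← mul_assoc, ← Real.exp_add]; ring_nf
  have h4 := (Real.continuous_exp.tendsto 0).comp (by simpa using h1.neg)
  simpa [boltzmann, Function.comp_def] using h4

/-- The damping suppresses rapidities `|x| > l`. -/
theorem tendsto_boltzmann_zero {s : ℝ} (hs : 1 < |s|) :
    Tendsto (fun l => boltzmann (Real.exp (-l)) (l * s)) atTop (𝓝 0) := by
  have h1 : Tendsto (fun l => Real.exp (-l) * Real.cosh (l * s)) atTop atTop := by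
    refine tendsto_atTop_mono' _ ?_ ((Real.tendsto_exp_atTop.comp
      (tendsto_id.atTop_mul_const (by linarith : 0 < |s| - 1))).atTop_div_const
        (zero_lt_two' ℝ))
    filter_upwards [eventually_ge_atTop 0] with l hl using half_exp_le l s hl
  exact Real.tendsto_exp_neg_atTop_nhds_zero.comp h1

/-- Around a rapidity `l * s` in the undamped region the iterated kernels tend to those without
damping. -/
theorem tendsto_iterKernel {s : ℝ} (hs : |s| < 1) (k : ℕ) (u v : ℝ) :
    Tendsto (fun l => iterKernel (wKernel (boltzmann (Real.exp (-l)))) k (l * s + u) (l * s + v))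
      atTop (𝓝 (iterKernel (wKernel fun _ => 1) k u v)) := by
  induction k generalizing u with
  | zero =>
    simp only [iterKernel, wKernel, add_sub_add_left_eq_sub]
    exact (tendsto_boltzmann_one hs u).mul_const _
  | succ k ih =>
    have hshift : ∀ l, iterKernel (wKernel (boltzmann (Real.exp (-l)))) (k + 1)
        (l * s + u) (l * s + v) = ∫ t, boltzmann (Real.exp (-l)) (l * s + u) * kern (u - t) *
          iterKernel (wKernel (boltzmann (Real.exp (-l)))) k (l * s + t) (l * s + v) := by
      intro l
      rw [iterKernel, ← integral_add_left_eq_self _ (l * s)]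
      simp only [wKernel, add_sub_add_left_eq_sub]
    simp_rw [hshift]
    have hw : ∀ l : ℝ, IsWeight (boltzmann (Real.exp (-l))) := fun l =>
      isWeight_boltzmann (Real.exp_pos _).le
    refine tendsto_integral_filter_of_dominated_convergence
      (fun t => kern (u - t) * (2 * Real.pi)⁻¹) (Eventually.of_forall fun l => ?_)
      (Eventually.of_forall fun l => ae_of_all _ fun t => ?_)
      ((integrable_kern_sub u).mul_const _) (ae_of_all _ fun t => ?_)
    · refine (Measurable.mul ?_ ?_).aestronglyMeasurable
      · exact measurable_const.mul
          (continuous_kern.measurable.comp (by fun_prop : Measurable fun t : ℝ => u - t))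
      · exact ((hw l).measurable_iterKernel_left k (l * s + v)).comp
          (by fun_prop : Measurable fun t : ℝ => l * s + t)
    · have h0 := (hw l).iterKernel_nonneg k (l * s + t) (l * s + v)
      have h1 := (hw l).iterKernel_le k (l * s + t) (l * s + v)
      have h2 := (hw l).nonneg (l * s + u)
      have h3 := (hw l).le_one (l * s + u)
      have h4 := (kern_pos (u - t)).le
      rw [Real.norm_of_nonneg (by positivity)]
      exact mul_le_mul (mul_le_of_le_one_left h4 h3) h1 h0 h4
    · rw [wKernel]
      exact ((tendsto_boltzmann_one hs u).mul_const _).mul (ih t)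

theorem kernelTrace_div (k : ℕ) {l : ℝ} (hl : 0 < l) :
    kernelTrace (wKernel (boltzmann (Real.exp (-l)))) k / l =
      ∫ s, iterKernel (wKernel (boltzmann (Real.exp (-l)))) k (l * s) (l * s) := by
  rw [Measure.integral_comp_mul_left
    (fun x => iterKernel (wKernel (boltzmann (Real.exp (-l)))) k x x) l, kernelTrace,
    abs_of_pos (inv_pos.2 hl), smul_eq_mul, div_eq_inv_mul]

theorem iterKernel_boltzmann_le (k : ℕ) {l : ℝ} (hl : 1 ≤ l) (s : ℝ) :
    iterKernel (wKernel (boltzmann (Real.exp (-l)))) k (l * s) (l * s) ≤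
      Real.exp (1 / 2) * (Real.cosh (s / 2))⁻¹ * ((2 * Real.pi ^ 2)⁻¹ * sechInt k) :=
  ((isWeight_boltzmann (Real.exp_pos _).le).iterKernel_diag_le k _).trans
    (mul_le_mul_of_nonneg_right (boltzmann_le l s hl)
      (mul_nonneg (by positivity) (sechInt_nonneg k)))

/-- At short distance the traces are extensive: the rapidities
fill an interval of length `2 * l`. -/
theorem tendsto_kernelTrace_div (k : ℕ) :
    Tendsto (fun l => kernelTrace (wKernel (boltzmann (Real.exp (-l)))) k / l) atTop
      (𝓝 (2 * ((2 * Real.pi ^ 2)⁻¹ * sechInt k))) := by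
  have hw : ∀ l : ℝ, IsWeight (boltzmann (Real.exp (-l))) := fun l =>
    isWeight_boltzmann (Real.exp_pos _).le
  set c := (2 * Real.pi ^ 2)⁻¹ * sechInt k with hc
  have hF : ∫ s, (Set.Ioo (-1 : ℝ) 1).indicator (fun _ => c) s = 2 * c := by
    rw [integral_indicator measurableSet_Ioo, setIntegral_const, Measure.real, Real.volume_Ioo]
    norm_num
  rw [← hF]
  refine Tendsto.congr' (f₁ := fun l =>
    ∫ s, iterKernel (wKernel (boltzmann (Real.exp (-l)))) k (l * s) (l * s)) ?_ ?_
  · filter_upwards [eventually_gt_atTop 0] with l hl using (kernelTrace_div k hl).symm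
  · refine tendsto_integral_filter_of_dominated_convergence
      (fun s => Real.exp (1 / 2) * (Real.cosh (s / 2))⁻¹ * c)
      (Eventually.of_forall fun l => ?_) ?_ (integrable_boltzmann_bound.mul_const _) ?_
    · exact (((hw l).measurable_iterKernel_diag k).comp
        (by fun_prop : Measurable fun s : ℝ => l * s)).aestronglyMeasurable
    · filter_upwards [eventually_ge_atTop 1] with l hl
      refine ae_of_all _ fun s => ?_
      rw [Real.norm_of_nonneg ((hw l).iterKernel_nonneg _ _ _)]
      exact iterKernel_boltzmann_le k hl s
    · have h1 : ∀ᵐ s : ℝ, s ≠ 1 := by simp [ae_iff]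
      have h2 : ∀ᵐ s : ℝ, s ≠ -1 := by simp [ae_iff]
      filter_upwards [h1, h2] with s hs1 hs2
      rcases lt_trichotomy |s| 1 with hs | hs | hs
      · rw [Set.indicator_of_mem (show s ∈ Set.Ioo (-1 : ℝ) 1 from abs_lt.1 hs), hc,
          ← iterKernel_one_diag k 0]
        simpa using tendsto_iterKernel hs k 0 0
      · rcases eq_or_eq_neg_of_abs_eq hs with h | h
        · exact absurd h hs1
        · exact absurd h hs2
      · rw [Set.indicator_of_notMem (show s ∉ Set.Ioo (-1 : ℝ) 1 from
          fun h => not_lt_of_gt hs (abs_lt.2 h))]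
        refine squeeze_zero (fun l => (hw l).iterKernel_nonneg _ _ _)
          (fun l => (hw l).iterKernel_diag_le k _) ?_
        have h3 := (tendsto_boltzmann_zero hs).mul_const c
        rwa [zero_mul] at h3

/-- Dominated convergence in the number of particles; the limit is `2 * ∑ (-1)^k c_k / (k + 1)`,
where `c_k` is the diagonal value of the undamped iterated kernel. -/
theorem tendsto_log_fredholm :
    Tendsto (fun l => Real.log (∑' n, fredholmTerm (wKernel (boltzmann (Real.exp (-l)))) n) / l)
      atTop (𝓝 (1 / 4)) := by
  set C : ℝ := ∫ s : ℝ, Real.exp (1 / 2) * (Real.cosh (s / 2))⁻¹ with hC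
  have hw : ∀ l : ℝ, IsWeight (boltzmann (Real.exp (-l))) := fun l =>
    isWeight_boltzmann (Real.exp_pos _).le
  have h1 : ∀ l, Real.log (∑' n, fredholmTerm (wKernel (boltzmann (Real.exp (-l)))) n) / l =
      ∑' k : ℕ, (-1) ^ k * (kernelTrace (wKernel (boltzmann (Real.exp (-l)))) k / l) /
        ((k : ℝ) + 1) := by
    intro l
    rw [(hw l).log_tsum_fredholmTerm (integrable_boltzmann (Real.exp_pos _)), ← tsum_div_const]
    refine tsum_congr fun k => ?_
    ring
  have h2 : ∑' k : ℕ, (-1) ^ k * (2 * ((2 * Real.pi ^ 2)⁻¹ * sechInt k)) / ((k : ℝ) + 1) =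
      1 / 4 := by
    rw [show (1 / 4 : ℝ) = 4 * (1 / 16) by norm_num, ← (hasSum_contribution.mul_left 4).tsum_eq]
    refine tsum_congr fun k => ?_
    field_simp
  simp_rw [h1]
  rw [← h2]
  refine tendsto_tsum_of_dominated_convergence
    (bound := fun k : ℕ => C * (2 * Real.pi ^ 2)⁻¹ * (sechInt k / ((k : ℝ) + 1)))
    (summable_sechInt.mul_left _)
    (fun k => ((tendsto_kernelTrace_div k).const_mul _).div_const _) ?_
  filter_upwards [eventually_ge_atTop 1] with l hl k
  have hl0 : 0 < l := zero_lt_one.trans_le hl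
  have h3 : kernelTrace (wKernel (boltzmann (Real.exp (-l)))) k / l ≤
      C * ((2 * Real.pi ^ 2)⁻¹ * sechInt k) := by
    rw [kernelTrace_div k hl0, hC, ← integral_mul_const]
    exact integral_mono_of_nonneg (ae_of_all _ fun s => (hw l).iterKernel_nonneg _ _ _)
      (integrable_boltzmann_bound.mul_const _) (ae_of_all _ fun s => iterKernel_boltzmann_le k hl s)
  have h4 : 0 ≤ kernelTrace (wKernel (boltzmann (Real.exp (-l)))) k / l :=
    div_nonneg ((hw l).kernelTrace_nonneg k) hl0.le
  rw [Real.norm_eq_abs, abs_div, abs_mul, abs_pow, abs_neg, abs_one, one_pow, one_mul,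
    abs_of_nonneg h4, abs_of_pos (by positivity : (0 : ℝ) < k + 1), ← mul_div_assoc, mul_assoc]
  exact div_le_div_of_nonneg_right h3 (by positivity)

theorem tendsto_log_twoPoint {m : ℝ} (hm : 0 < m) :
    Tendsto (fun τ : ℝ => Real.log (twoPoint m τ) / Real.log (m * τ)) (𝓝[>] 0)
      (𝓝 (-4 * dimension)) := by
  have h1 : Tendsto (fun τ : ℝ => -Real.log (m * τ)) (𝓝[>] 0) atTop := by
    refine tendsto_neg_atBot_atTop.comp (Real.tendsto_log_nhdsGT_zero.comp ?_)
    refine tendsto_nhdsWithin_iff.2 ⟨?_, ?_⟩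
    · have : Tendsto (fun τ : ℝ => m * τ) (𝓝 0) (𝓝 (m * 0)) := tendsto_id.const_mul m
      rw [mul_zero] at this
      exact this.mono_left nhdsWithin_le_nhds
    · filter_upwards [self_mem_nhdsWithin] with τ hτ using mul_pos hm hτ
  have h2 := (tendsto_log_fredholm.comp h1).neg
  rw [dimension_eq, show (-4 * (1 / 16) : ℝ) = -(1 / 4) by norm_num]
  refine h2.congr' ?_
  filter_upwards [self_mem_nhdsWithin] with τ hτ
  simp only [Function.comp_apply, neg_neg]
  rw [Real.exp_log (mul_pos hm hτ), twoPoint, twoPointTerm_eq, div_neg, neg_neg]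

end ShortDistance

end ScalingIsing

open ScalingIsing in
theorem mainTheorem1 (m : ℝ) (hm : 0 < m) :
    -- the functions `gₙ` of the operator `μ + √(2i) σ`
    (∀ (n : ℕ) (θ : Fin n → ℝ), ScalingIsing.g n θ =
      ((2 * Real.pi) ^ n)⁻¹ *
        ∏ i : Fin n, ∏ j ∈ Finset.Ioi i, Real.tanh ((θ i - θ j) / 2) ^ 2) ∧
    -- the integrals over the connected parts converge
    (∀ n : ℕ, Integrable
      (fun θ : Fin n → ℝ => ScalingIsing.h (n + 1) (Fin.snoc (α := fun _ => ℝ) θ 0))) ∧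
    -- values and recursion of the integrals `Iₙ`
    ScalingIsing.rapidityIntegral 1 = 1 ∧
    ScalingIsing.rapidityIntegral 2 = -4 ∧
    ScalingIsing.rapidityIntegral 3 = 4 * Real.pi ^ 2 ∧
    (∀ n : ℕ, 3 ≤ n → ScalingIsing.rapidityIntegral n =
      ((n : ℝ) - 2) ^ 2 * ScalingIsing.rapidityIntegral 3 *
        ScalingIsing.rapidityIntegral (n - 2)) ∧
    -- the contributions of the odd and of the even particle numbers
    (∀ k : ℕ, 1 / 2 * (((2 * k + 1).factorial : ℝ)⁻¹ * (1 / (2 * Real.pi)) ^ (2 * k + 1) *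
        ScalingIsing.rapidityIntegral (2 * k + 1)) =
      1 / (4 * Real.pi) * (Real.Gamma (2 * k + 1) ^ 2 /
        (Real.Gamma (k + 1) ^ 2 * Real.Gamma (2 * k + 2)) * ((4 : ℝ) ^ k)⁻¹)) ∧
    (∀ k : ℕ, 1 ≤ k → 1 / 2 * (((2 * k).factorial : ℝ)⁻¹ * (1 / (2 * Real.pi)) ^ (2 * k) *
        ScalingIsing.rapidityIntegral (2 * k)) =
      -(1 / (8 * Real.pi ^ 2) * (Real.Gamma k ^ 2 / Real.Gamma (2 * k + 1) * (4 : ℝ) ^ k))) ∧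
    HasSum (fun k : ℕ => 1 / 2 * (((2 * k + 1).factorial : ℝ)⁻¹ *
      (1 / (2 * Real.pi)) ^ (2 * k + 1) *
        ScalingIsing.rapidityIntegral (2 * k + 1))) (1 / 8) ∧
    HasSum (fun k : ℕ => 1 / 2 * (((2 * (k + 1)).factorial : ℝ)⁻¹ *
      (1 / (2 * Real.pi)) ^ (2 * (k + 1)) *
        ScalingIsing.rapidityIntegral (2 * (k + 1)))) (-(1 / 16)) ∧
    -- the sum over all particle numbers `n + 1 ≥ 1`
    HasSum (fun n : ℕ => 1 / 2 * (((n + 1).factorial : ℝ)⁻¹ * (1 / (2 * Real.pi)) ^ (n + 1) *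
      ScalingIsing.rapidityIntegral (n + 1))) ScalingIsing.dimension ∧
    ScalingIsing.dimension = 1 / 16 ∧
    -- `Δ` is the short-distance exponent of the two-point function, `w ≈ (mτ)^{-4Δ}`
    (∀ τ : ℝ, 0 < τ →
      (∀ n : ℕ, Integrable (ScalingIsing.twoPointIntegrand m τ n)) ∧
      Summable (ScalingIsing.twoPointTerm m τ)) ∧
    Tendsto (fun τ : ℝ => Real.log (ScalingIsing.twoPoint m τ) / Real.log (m * τ))
      (𝓝[>] 0) (𝓝 (-4 * ScalingIsing.dimension)) := by
  refine ⟨g_eq, integrable_h_snoc, rapidityIntegral_one, rapidityIntegral_two,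
    rapidityIntegral_three, ?_, odd_contribution_eq_Gamma, even_contribution_eq_Gamma, ?_, ?_, ?_,
    dimension_eq, ?_, tendsto_log_twoPoint hm⟩
  · intro n hn
    obtain ⟨k, rfl⟩ := Nat.exists_eq_add_of_le' hn
    rw [rapidityIntegral_add_three, rapidityIntegral_three, show k + 3 - 2 = k + 1 by omega]
    push_cast
    ring
  · exact hasSum_contribution_odd.congr_fun fun k => (contribution_eq (2 * k))
  · exact hasSum_contribution_even.congr_fun fun k => (contribution_eq (2 * k + 1))
  · rw [dimension_eq]
    exact hasSum_contribution.congr_fun fun n => (contribution_eq n)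
  · intro τ hτ
    have hint := integrable_boltzmann (mul_pos hm hτ)
    refine ⟨fun n => ?_, ?_⟩
    · rw [show twoPointIntegrand m τ n = _ from funext (twoPointIntegrand_eq m τ n)]
      exact integrable_kernelDet hint n
    · rw [twoPointTerm_eq]
      exact (isWeight_boltzmann (mul_pos hm hτ).le).summable_fredholmTerm hint
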